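/- **Theorem.** Let $(\cdot,\cdot)$ be the Hilbert symbol of $\mathbb Q_2$. For $g=\begin{pmatrix}a&b\\c&d\end{pmatrix}\in \mathrm{SL}_2(\mathbb Q_2)$ put $x(g)=c$ if $c\ne0$ and $x(g)=d$ if $c=0$; put $s(g)=(c,d)$ if $cd\neq0$ and $\mathrm{ord}(c)$ is odd, and $s(g)=1$ otherwise. Let $G$ be the two-fold central extension $\mathrm{SL}_2(\mathbb Q_2)\times\{\pm1\}$ of $\mathrm{SL}_2(\mathbb Q_2)$ with the multiplication $(g_1,\epsilon_1)(g_2,\epsilon_2)=(g_1g_2,\epsilon_1\epsilon_2\sigma(g_1,g_2))$, where $$\sigma(g_1,g_2)=\bigl(x(g_1g_2)x(g_1),\,x(g_1g_2)x(g_2)\bigr)\,s(g_1)s(g_2)s(g_1g_2),$$ topologized so that the sets $\{(k,1): k\in \mathrm{SL}_2(\mathbb Z_2),\ k\equiv 1 \bmod 2^n\}$, $n\ge 2$, are a basis of neighbourhoods of the identity. Let $K$ and $K_0$ be the full inverse images in $G$ of $\mathrm{SL}_2(\mathbb Z_2)$ and of $\{\begin{pmatrix}a&b\\c&d\end{pmatrix}\in\mathrm{SL}_2(\mathbb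 Z_2): c\in4\mathbb Z_2\}$, and let $K_1=\{(\begin{pmatrix}a&b\\c&d\end{pmatrix},1): \begin{pmatrix}a&b\\c&d\end{pmatrix}\in\mathrm{SL}_2(\mathbb Z_2),\ a\in1+4\mathbb Z_2,\ c\in4\mathbb Z_2\}$. Then $K_0=M\times K_1$, where $M$ is the center of $G$. Let $\gamma:M\to\mathbb C^\times$ be a genuine character, that is, $\gamma((1,-1))=-1$, extended to $K_0$ so that it is trivial on $K_1$. Put $w=(\begin{pmatrix}0&1\\-1&0\end{pmatrix},1)$, $h(-1)=(-1,1)$ and $\zeta=(1+\gamma(h(-1)))/\sqrt2$. Let $T_w$ be the function on $G$ supported on $K_0wK_0$ with $$T_w(k\,w\,k')=\tfrac1{\sqrt2}\,\overline{\gamma(k)}\,\overline{\zeta}\,\overline{\gamma(k')}\qquad(k,k'\in K_0),$$ let $\mathbf 1$ be the function supported on $K_0$ and equal to $\overline\gamma$ there, and let $F_2=\tfrac13(T_w+\mathbf 1)$ and $\hat F_2(g)=F_2(g^{-1})$. Integrals are taken with respect to the Haar measure of $G$ for which $K_0$ has measure $1$. Let $K$ act by right translation on $I_K(\gamma)=\{\phi:K\to\mathbb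 C \mid \phi(k_0k)=\gamma(k_0)\phi(k)\ \text{for all } k_0\in K_0,\ k\in K\}$, and let $V(2)=\{\int_K \hat F_2(k)\,\phi(k^{-1}\,\cdot\,)\,dk \mid \phi\in I_K(\gamma)\}$, a $K$-subrepresentation of $I_K(\gamma)$. For a smooth complex representation $(\pi,V)$ of $G$ with central character $\gamma$, a *$\gamma$-spherical vector* is a nonzero vector $v\in V^\gamma=\{v\in V:\pi(k)v=\gamma(k)v\ \text{for all } k\in K_0\}$ with $\int_G T_w(g)\pi(g)v\,dg=2v$; the representation is *$\gamma$-unramified* if it contains a $\gamma$-spherical vector. Then: 1. $V(2)$ is an irreducible representation of $K$ of dimension $2$, and $\hat F_2|_K\in V(2)$. 2. A smooth representation $V$ of $G$ with central character $\gamma$ is $\gamma$-unramified if and only if there is a nonzero $K$-homomorphism $l:V(2)\to V$. 3. If $l:V(2)\to V$ is a nonzero $K$-homomorphism, then every nonzero scalar multiple of $l(\hat F_2)$ is a $\gamma$-spherical vector of $V$. -/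

import Mathlib

set_option linter.unusedSimpArgs false

namespace DyadicCover

noncomputable section

open Classical in
/-- The Hilbert symbol `(a, b)` over `ℚ₂` (for nonzero `a`, `b`): it is `1` if
`z² = a x² + b y²` has a nonzero solution in `ℚ₂`, and `-1` otherwise. -/
def hilbertSymbol (a b : ℚ_[2]) : ℤˣ :=
  if ∃ x y z : ℚ_[2], (x ≠ 0 ∨ y ≠ 0 ∨ z ≠ 0) ∧ z ^ 2 = a * x ^ 2 + b * y ^ 2 then 1 else -1

namespace hilbertSymbol

lemma symm (a b : ℚ_[2]) : hilbertSymbol a b = hilbertSymbol b a := by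
  unfold hilbertSymbol
  congr 1
  refine propext ⟨?_, ?_⟩ <;>
  · rintro ⟨x, y, z, h, e⟩
    exact ⟨y, x, z, by tauto, by rw [e]; ring⟩

lemma eq_one {a b : ℚ_[2]} (x y z : ℚ_[2]) (h : x ≠ 0 ∨ y ≠ 0 ∨ z ≠ 0)
    (e : z ^ 2 = a * x ^ 2 + b * y ^ 2) : hilbertSymbol a b = 1 :=
  if_pos ⟨x, y, z, h, e⟩

lemma mul_sq_left (a b s : ℚ_[2]) (hs : s ≠ 0) :
    hilbertSymbol (s ^ 2 * a) b = hilbertSymbol a b := by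
  unfold hilbertSymbol
  congr 1
  refine propext ⟨?_, ?_⟩
  · rintro ⟨x, y, z, h, e⟩
    refine ⟨s * x, y, z, ?_, by rw [e]; ring⟩
    rcases h with h | h | h
    · exact Or.inl (mul_ne_zero hs h)
    · exact Or.inr (Or.inl h)
    · exact Or.inr (Or.inr h)
  · rintro ⟨x, y, z, h, e⟩
    refine ⟨s⁻¹ * x, y, z, ?_, by rw [e]; field_simp⟩
    rcases h with h | h | h
    · exact Or.inl (mul_ne_zero (inv_ne_zero hs) h)
    · exact Or.inr (Or.inl h)
    · exact Or.inr (Or.inr h)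

lemma mul_sq_right (a b s : ℚ_[2]) (hs : s ≠ 0) :
    hilbertSymbol a (s ^ 2 * b) = hilbertSymbol a b := by
  rw [symm, mul_sq_left _ _ _ hs, symm]

lemma exists_sq_of_dvd (n : ℤ_[2]) (h : (8 : ℤ_[2]) ∣ n - 1) : ∃ z : ℤ_[2], z ^ 2 = n := by
  have hn : ‖n - 1‖ ≤ 1 / 8 := by
    obtain ⟨m, hm⟩ := h
    have h8 : ‖(8 : ℤ_[2])‖ = 1 / 8 := by
      have : (8 : ℤ_[2]) = (2 : ℕ) ^ 3 := by norm_num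
      rw [this, norm_pow, PadicInt.norm_p]; norm_num
    rw [hm, norm_mul, h8]
    have := m.norm_le_one
    linarith
  have h2 : ‖(2 : ℤ_[2])‖ = 1 / 2 := by
    have := PadicInt.norm_p (p := 2)
    norm_num at this ⊢
    exact this
  have := hensels_lemma (p := 2) (R := ℤ_[2])
    (F := (Polynomial.X ^ 2 - Polynomial.C n : Polynomial ℤ_[2])) (a := 1) (by
      simp
      rw [one_add_one_eq_two, h2, norm_sub_rev]
      linarith)
  obtain ⟨z, hz, -⟩ := this
  refine ⟨z, ?_⟩
  simpa [sub_eq_zero] using hz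

lemma exists_sq_of_mod (n : ℤ) (h : n % 8 = 1 ∨ n % 32 = 4) :
    ∃ z : ℚ_[2], z ≠ 0 ∧ z ^ 2 = (n : ℚ_[2]) := by
  rcases h with h | h
  · obtain ⟨k, hk⟩ : ∃ k, n = 8 * k + 1 := ⟨n / 8, by omega⟩
    obtain ⟨z, hz⟩ := exists_sq_of_dvd (n : ℤ_[2]) ⟨k, by rw [hk]; push_cast; ring⟩
    have hz' : (z : ℚ_[2]) ^ 2 = n := by
      have := congrArg (fun t : ℤ_[2] => (t : ℚ_[2])) hz
      simpa using this
    refine ⟨z, fun h0 => ?_, hz'⟩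
    rw [h0] at hz'
    have : n = 0 := by exact_mod_cast (by simpa using hz'.symm : (n : ℚ_[2]) = 0)
    omega
  · obtain ⟨k, hk⟩ : ∃ k, n = 4 * (8 * k + 1) := ⟨n / 32, by omega⟩
    obtain ⟨z, hz⟩ := exists_sq_of_dvd ((8 * k + 1 : ℤ) : ℤ_[2]) ⟨k, by push_cast; ring⟩
    have hz' : (2 * (z : ℚ_[2])) ^ 2 = n := by
      have := congrArg (fun t : ℤ_[2] => (t : ℚ_[2])) hz
      have h8 : ((8 : ℤ_[2]) : ℚ_[2]) = 8 := rfl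
      simp [h8] at this
      rw [mul_pow, this, hk]; push_cast; ring
    refine ⟨2 * z, fun h0 => ?_, hz'⟩
    rw [h0] at hz'
    have : n = 0 := by exact_mod_cast (by simpa using hz'.symm : (n : ℚ_[2]) = 0)
    omega

/-- Representatives of the square classes of `ℚ₂`. -/
def rep (i j k : ℕ) : ℤ := (-1) ^ i * 2 ^ j * 5 ^ k

lemma rep_pos : ∀ i j k i' j' k' : Fin 2, (i * i' + j * k' + k * j' : ℕ) % 2 = 0 →
    ∃ x y : Fin 4, ((rep i j k * x ^ 2 + rep i' j' k' * y ^ 2 = 0 ∧ x ≠ 0) ∨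
      (rep i j k * x ^ 2 + rep i' j' k' * y ^ 2) % 8 = 1 ∨
      (rep i j k * x ^ 2 + rep i' j' k' * y ^ 2) % 32 = 4) := by
  decide +kernel

/-- The squares modulo 16. -/
def sqMod : Fin 4 → ZMod 16 := ![0, 1, 4, 9]

lemma rep_neg : ∀ i j k i' j' k' : Fin 2, (i * i' + j * k' + k * j' : ℕ) % 2 = 1 →
    ∀ X Y Z : Fin 4, sqMod Z = rep i j k * sqMod X + rep i' j' k' * sqMod Y →
      (X = 0 ∨ X = 2) ∧ (Y = 0 ∨ Y = 2) ∧ (Z = 0 ∨ Z = 2) := by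
  decide +kernel

lemma sq_mem : ∀ x : ZMod 16, ∃ X, x ^ 2 = sqMod X ∧ (X = 0 ∨ X = 2 → ¬ IsUnit x) := by
  decide +kernel

lemma rep_eq_sq_mul (i j k : ℕ) : rep i j k =
    ((2 ^ (j / 2) * 5 ^ (k / 2) : ℕ) : ℤ) ^ 2 * rep (i % 2) (j % 2) (k % 2) := by
  have h (b : ℤ) (n : ℕ) : b ^ n = (b ^ (n / 2)) ^ 2 * b ^ (n % 2) := by
    conv_lhs => rw [← Nat.div_add_mod n 2, pow_add, mul_comm 2, pow_mul]
  have h1 : (((-1 : ℤ)) ^ (i / 2)) ^ 2 = 1 := by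
    rw [← pow_mul, mul_comm, pow_mul]; norm_num
  unfold rep
  rw [h (-1) i, h 2 j, h 5 k, h1]
  push_cast
  ring

lemma exists_primitive (x y z : ℚ_[2]) (h : x ≠ 0 ∨ y ≠ 0 ∨ z ≠ 0) :
    ∃ (t : ℚ_[2]) (x' y' z' : ℤ_[2]), (IsUnit x' ∨ IsUnit y' ∨ IsUnit z') ∧
      x = t * x' ∧ y = t * y' ∧ z = t * z' := by
  obtain ⟨t, ht, htx, hty, htz, hmem⟩ : ∃ t : ℚ_[2], t ≠ 0 ∧ ‖x‖ ≤ ‖t‖ ∧ ‖y‖ ≤ ‖t‖ ∧ ‖z‖ ≤ ‖t‖ ∧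
      (t = x ∨ t = y ∨ t = z) := by
    have key : ∃ t : ℚ_[2], ‖x‖ ≤ ‖t‖ ∧ ‖y‖ ≤ ‖t‖ ∧ ‖z‖ ≤ ‖t‖ ∧ (t = x ∨ t = y ∨ t = z) := by
      rcases le_total ‖x‖ ‖y‖ with h1 | h1 <;> rcases le_total ‖y‖ ‖z‖ with h2 | h2 <;>
        rcases le_total ‖x‖ ‖z‖ with h3 | h3
      · exact ⟨z, h3, h2, le_rfl, by simp⟩
      · exact ⟨z, h1.trans h2, h2, le_rfl, by simp⟩
      · exact ⟨y, h1, le_rfl, h2, by simp⟩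
      · exact ⟨y, h1, le_rfl, h2, by simp⟩
      · exact ⟨z, h3, h2, le_rfl, by simp⟩
      · exact ⟨x, le_rfl, h1, h3, by simp⟩
      · exact ⟨z, h3, h1.trans h3, le_rfl, by simp⟩
      · exact ⟨x, le_rfl, h1, h3, by simp⟩
    obtain ⟨t, a, b, c, d⟩ := key
    refine ⟨t, ?_, a, b, c, d⟩
    rintro rfl
    simp at a b c
    tauto
  have hpos : 0 < ‖t‖ := norm_pos_iff.2 ht
  have lift (w : ℚ_[2]) (hw : ‖w‖ ≤ ‖t‖) : ∃ w' : ℤ_[2], (w' : ℚ_[2]) = w / t :=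
    ⟨⟨w / t, by rwa [norm_div, div_le_one hpos]⟩, rfl⟩
  obtain ⟨x', hx⟩ := lift x htx
  obtain ⟨y', hy⟩ := lift y hty
  obtain ⟨z', hz⟩ := lift z htz
  have unit (w' : ℤ_[2]) (hw : (w' : ℚ_[2]) = t / t) : IsUnit w' := by
    rw [PadicInt.isUnit_iff, PadicInt.norm_def, hw, div_self ht, norm_one]
  refine ⟨t, x', y', z', ?_, ?_, ?_, ?_⟩
  · rcases hmem with rfl | rfl | rfl
    · exact Or.inl (unit x' hx)
    · exact Or.inr (Or.inl (unit y' hy))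
    · exact Or.inr (Or.inr (unit z' hz))
  · rw [hx]; field_simp
  · rw [hy]; field_simp
  · rw [hz]; field_simp

lemma unit_mod_eight : ∀ u : ZMod 8, IsUnit u → ∃ i k : Fin 2, (rep i 0 k : ZMod 8) * u = 1 := by
  decide +kernel

lemma exists_rep (a : ℚ_[2]) (ha : a ≠ 0) :
    ∃ (i j k : ℕ) (s : ℚ_[2]), s ≠ 0 ∧ a = s ^ 2 * (rep i j k : ℤ) := by
  obtain ⟨u, hu, n, hn⟩ : ∃ u : ℤ_[2], IsUnit u ∧ ∃ n : ℤ, a = (u : ℚ_[2]) * 2 ^ n := by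
    have h2 : ‖a * 2 ^ (-a.valuation)‖ = 1 := by
      have h2' : ‖(2 : ℚ_[2])‖ = 2⁻¹ := by simpa using Padic.norm_p (p := 2)
      rw [norm_mul, Padic.norm_eq_zpow_neg_valuation ha, norm_zpow, h2']
      push_cast
      rw [inv_zpow, ← zpow_neg, ← zpow_add₀ (by norm_num)]
      simp
    refine ⟨⟨_, h2.le⟩, PadicInt.isUnit_iff.2 h2, a.valuation, ?_⟩
    change a = a * 2 ^ (-a.valuation) * 2 ^ a.valuation
    rw [mul_assoc, ← zpow_add₀ (by norm_num)]
    simp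
  obtain ⟨i, k, hik⟩ := unit_mod_eight (PadicInt.toZModPow (p := 2) 3 u) (hu.map _)
  have h8 : (8 : ℤ_[2]) ∣ (rep i 0 k : ℤ) * u - 1 := by
    have : (rep i 0 k : ℤ) * u - 1 ∈ RingHom.ker (PadicInt.toZModPow (p := 2) 3) := by
      rw [RingHom.mem_ker, map_sub, map_mul, map_intCast, map_one, sub_eq_zero]
      exact hik
    rw [PadicInt.ker_toZModPow, Ideal.mem_span_singleton] at this
    norm_num at this
    exact this
  obtain ⟨z, hz⟩ := exists_sq_of_dvd _ h8
  have hz' : (z : ℚ_[2]) ^ 2 = (rep i 0 k : ℤ) * u := by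
    have := congrArg (fun t : ℤ_[2] => (t : ℚ_[2])) hz
    simpa using this
  have hr : ((rep i 0 k : ℤ) : ℚ_[2]) ≠ 0 := by
    unfold rep; push_cast; simp
  have hu0 : (u : ℚ_[2]) ≠ 0 := by
    intro h; apply hu.ne_zero; exact Subtype.ext h
  have hz0 : (z : ℚ_[2]) ≠ 0 := by
    intro h; rw [h] at hz'
    exact mul_ne_zero hr hu0 (by simpa using hz'.symm)
  have hu' : (u : ℚ_[2]) = (z / (rep i 0 k : ℤ)) ^ 2 * (rep i 0 k : ℤ) := by
    rw [div_pow, hz']; field_simp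
  have hrep : ∀ j, ((rep i j k : ℤ) : ℚ_[2]) = (rep i 0 k : ℤ) * 2 ^ j := by
    intro j; unfold rep; push_cast; ring
  have hs0 (m : ℤ) : (z : ℚ_[2]) / (rep i 0 k : ℤ) * 2 ^ m ≠ 0 :=
    mul_ne_zero (div_ne_zero hz0 hr) (zpow_ne_zero _ (by norm_num))
  have hsq (m : ℤ) : (2 : ℚ_[2]) ^ (m * 2) = (2 ^ m) ^ 2 := by
    rw [zpow_mul]; norm_cast
  obtain ⟨m, hm | hm⟩ := Int.even_or_odd' n
  · refine ⟨i, 0, k, z / (rep i 0 k : ℤ) * 2 ^ m, hs0 m, ?_⟩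
    rw [hn, hu', hm, mul_comm 2 m, hsq]
    ring
  · refine ⟨i, 1, k, z / (rep i 0 k : ℤ) * 2 ^ m, hs0 m, ?_⟩
    rw [hn, hu', hm, mul_comm 2 m, zpow_add₀ (by norm_num), hsq, hrep 1, zpow_one]
    ring

lemma rep_symbol (i j k i' j' k' : Fin 2) :
    hilbertSymbol (rep i j k : ℤ) (rep i' j' k' : ℤ) = (-1) ^ (i * i' + j * k' + k * j' : ℕ) := by
  rcases Nat.mod_two_eq_zero_or_one (i * i' + j * k' + k * j' : ℕ) with h | h
  · rw [(Nat.even_iff.2 h).neg_one_pow]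
    obtain ⟨x, y, (⟨h0, hx⟩ | h1)⟩ := rep_pos i j k i' j' k' h
    · refine eq_one ((x : ℕ) : ℚ_[2]) ((y : ℕ) : ℚ_[2]) 0 (Or.inl ?_) ?_
      · exact Nat.cast_ne_zero.2 fun h => hx (Fin.ext h)
      · have := congrArg (fun t : ℤ => (t : ℚ_[2])) h0
        push_cast at this
        rw [this]; ring
    · obtain ⟨z, hz0, hz⟩ := exists_sq_of_mod _ h1
      refine eq_one ((x : ℕ) : ℚ_[2]) ((y : ℕ) : ℚ_[2]) z (Or.inr (Or.inr hz0)) ?_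
      rw [hz]; push_cast; ring
  · rw [(Nat.odd_iff.2 h).neg_one_pow]
    refine if_neg ?_
    rintro ⟨x, y, z, hne, e⟩
    obtain ⟨t, x', y', z', hu, hx, hy, hz⟩ := exists_primitive x y z hne
    have ht : t ≠ 0 := by
      rintro rfl
      simp at hx hy hz
      tauto
    have e' : z' ^ 2 = (rep i j k : ℤ) * x' ^ 2 + (rep i' j' k' : ℤ) * y' ^ 2 := by
      have : ((z' ^ 2 : ℤ_[2]) : ℚ_[2]) =
          (((rep i j k : ℤ) * x' ^ 2 + (rep i' j' k' : ℤ) * y' ^ 2 : ℤ_[2]) : ℚ_[2]) := by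
        push_cast
        rw [hx, hy, hz] at e
        have h2 := pow_ne_zero 2 ht
        apply mul_left_cancel₀ h2
        linear_combination e
      exact Subtype.ext this
    let φ : ℤ_[2] →+* ZMod 16 := PadicInt.toZModPow (p := 2) 4
    have e2 := congrArg φ e'
    simp only [map_pow, map_add, map_mul, map_intCast] at e2
    obtain ⟨X, hX, hX'⟩ := sq_mem (φ x')
    obtain ⟨Y, hY, hY'⟩ := sq_mem (φ y')
    obtain ⟨Z, hZ, hZ'⟩ := sq_mem (φ z')
    rw [hX, hY, hZ] at e2
    obtain ⟨h1, h2, h3⟩ := rep_neg i j k i' j' k' h X Y Z e2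
    rcases hu with hu | hu | hu
    · exact hX' h1 (hu.map φ)
    · exact hY' h2 (hu.map φ)
    · exact hZ' h3 (hu.map φ)

lemma rep_symbol_nat (i j k i' j' k' : ℕ) :
    hilbertSymbol (rep i j k : ℤ) (rep i' j' k' : ℤ) = (-1) ^ (i * i' + j * k' + k * j') := by
  rw [rep_eq_sq_mul i j k, rep_eq_sq_mul i' j' k']
  push_cast
  have h0 (m n : ℕ) : (2 : ℚ_[2]) ^ m * 5 ^ n ≠ 0 := by simp
  rw [mul_sq_left _ _ _ (h0 _ _), mul_sq_right _ _ _ (h0 _ _)]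
  have := rep_symbol ⟨i % 2, Nat.mod_lt _ two_pos⟩ ⟨j % 2, Nat.mod_lt _ two_pos⟩
    ⟨k % 2, Nat.mod_lt _ two_pos⟩ ⟨i' % 2, Nat.mod_lt _ two_pos⟩ ⟨j' % 2, Nat.mod_lt _ two_pos⟩
    ⟨k' % 2, Nat.mod_lt _ two_pos⟩
  refine this.trans ?_
  have h1 : (-1 : ℤˣ) ^ 2 = 1 := by norm_num
  rw [pow_eq_pow_mod _ h1, pow_eq_pow_mod (i * i' + j * k' + k * j') h1]
  congr 1
  simp [Nat.add_mod, Nat.mul_mod]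

lemma mul_right' (a b c : ℚ_[2]) (ha : a ≠ 0) (hb : b ≠ 0) (hc : c ≠ 0) :
    hilbertSymbol a (b * c) = hilbertSymbol a b * hilbertSymbol a c := by
  obtain ⟨i, j, k, s, hs, rfl⟩ := exists_rep a ha
  obtain ⟨i', j', k', t, ht, rfl⟩ := exists_rep b hb
  obtain ⟨i'', j'', k'', u, hu, rfl⟩ := exists_rep c hc
  have : t ^ 2 * ((rep i' j' k' : ℤ) : ℚ_[2]) * (u ^ 2 * (rep i'' j'' k'' : ℤ)) =
      (t * u) ^ 2 * (rep (i' + i'') (j' + j'') (k' + k'') : ℤ) := by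
    unfold rep; push_cast; ring
  rw [this, mul_sq_left _ _ _ hs, mul_sq_left _ _ _ hs, mul_sq_left _ _ _ hs,
    mul_sq_right _ _ _ ht, mul_sq_right _ _ _ hu, mul_sq_right _ _ _ (mul_ne_zero ht hu),
    rep_symbol_nat, rep_symbol_nat, rep_symbol_nat, ← pow_add]
  congr 1
  ring


lemma neg_self (a : ℚ_[2]) : hilbertSymbol a (-a) = 1 :=
  eq_one 1 1 0 (Or.inl one_ne_zero) (by ring)

lemma of_add_eq_one (a b : ℚ_[2]) (h : a + b = 1) : hilbertSymbol a b = 1 :=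
  eq_one 1 1 1 (Or.inl one_ne_zero) (by linear_combination -h)

end hilbertSymbol

/-- The Hilbert symbol on units. -/
def hilbertUnits (a b : ℚ_[2]ˣ) : ℤˣ := hilbertSymbol a b

namespace hilbertUnits

lemma symm (a b : ℚ_[2]ˣ) : hilbertUnits a b = hilbertUnits b a := hilbertSymbol.symm _ _

lemma mul_right (a b c : ℚ_[2]ˣ) :
    hilbertUnits a (b * c) = hilbertUnits a b * hilbertUnits a c := by
  unfold hilbertUnits
  rw [Units.val_mul]
  exact hilbertSymbol.mul_right' _ _ _ a.ne_zero b.ne_zero c.ne_zero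

lemma mul_left (a b c : ℚ_[2]ˣ) :
    hilbertUnits (a * b) c = hilbertUnits a c * hilbertUnits b c := by
  rw [symm, mul_right, symm c, symm c]

lemma one_right (a : ℚ_[2]ˣ) : hilbertUnits a 1 = 1 := by
  simpa using mul_right a 1 1

lemma one_left (a : ℚ_[2]ˣ) : hilbertUnits 1 a = 1 := by
  rw [symm, one_right]

lemma inv_right (a b : ℚ_[2]ˣ) : hilbertUnits a b⁻¹ = hilbertUnits a b := by
  have := mul_right a b b⁻¹
  rw [mul_inv_cancel, one_right, eq_comm, mul_eq_one_iff_eq_inv] at this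
  rw [this, Int.units_inv_eq_self]

lemma inv_left (a b : ℚ_[2]ˣ) : hilbertUnits a⁻¹ b = hilbertUnits a b := by
  rw [symm, inv_right, symm]

lemma neg_self (a : ℚ_[2]ˣ) : hilbertUnits a (-a) = 1 := by
  unfold hilbertUnits
  simpa using hilbertSymbol.neg_self a

lemma self (a : ℚ_[2]ˣ) : hilbertUnits a a = hilbertUnits a (-1) := by
  have := neg_self a
  rw [neg_eq_neg_one_mul, mul_right, mul_eq_one_iff_eq_inv, Int.units_inv_eq_self] at this
  exact this.symm

lemma cancel (a b : ℤˣ) : a * (a * b) = b := by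
  rw [← mul_assoc, Int.units_mul_self, one_mul]

/-- The cocycle identity for the factor `(x(g₁g₂)x(g₁), x(g₁g₂)x(g₂))` of `σ`, written in the
values `a, b, c, d, e, f` of `x` at `g₁, g₂, g₃, g₁g₂, g₂g₃, g₁g₂g₃`. -/
def IsCoc (a b c d e f : ℚ_[2]ˣ) : Prop :=
  hilbertUnits (d * a) (d * b) * hilbertUnits (f * d) (f * c) =
    hilbertUnits (f * a) (f * e) * hilbertUnits (e * b) (e * c)

lemma coc_A (a b c e : ℚ_[2]ˣ) : IsCoc a b c (a * b) e (a * e) := by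
  unfold IsCoc
  simp only [mul_left, mul_right, self, symm _ a, symm c b, symm e b, symm e c]
  generalize hilbertUnits a b = x1, hilbertUnits a c = x2, hilbertUnits a e = x3,
    hilbertUnits b c = x4, hilbertUnits b e = x5, hilbertUnits c e = x6
  simp [mul_assoc, mul_left_comm, mul_comm, cancel]

lemma coc_G (a b c d e f : ℚ_[2]ˣ) (h : (b * f + a * c : ℚ_[2]) = d * e) : IsCoc a b c d e f := by
  have S : hilbertUnits (b * f * d⁻¹ * e⁻¹) (a * c * d⁻¹ * e⁻¹) = 1 := by
    apply hilbertSymbol.of_add_eq_one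
    push_cast
    field_simp
    linear_combination h
  unfold IsCoc
  rw [← mul_inv_eq_one, ← S, Int.units_inv_eq_self]
  clear S
  simp only [mul_left, mul_right, inv_left, inv_right]
  simp only [self]
  simp only [symm b a, symm c a, symm d a, symm e a, symm f a, symm c b, symm d b, symm e b,
    symm f b, symm d c, symm e c, symm f c, symm e d, symm f d, symm f e]
  generalize hilbertUnits a b = x1, hilbertUnits a c = x2, hilbertUnits a d = x3,
    hilbertUnits a e = x4, hilbertUnits a f = x5, hilbertUnits b c = x6, hilbertUnits b d = x7,
    hilbertUnits b e = x8, hilbertUnits b f = x9, hilbertUnits c d = x10, hilbertUnits c e = x11,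
    hilbertUnits c f = x12, hilbertUnits d e = x13, hilbertUnits d f = x14,
    hilbertUnits e f = x15, hilbertUnits a (-1) = y1, hilbertUnits b (-1) = y2, 
    hilbertUnits c (-1) = y3, hilbertUnits d (-1) = y4, hilbertUnits e (-1) = y5,
    hilbertUnits f (-1) = y6
  simp [mul_assoc, mul_left_comm, mul_comm, cancel]

lemma sq_right (a t : ℚ_[2]ˣ) : hilbertUnits a (t ^ 2) = 1 := by
  rw [pow_two, mul_right, Int.units_mul_self]

lemma sq_left (a t : ℚ_[2]ˣ) : hilbertUnits (t ^ 2) a = 1 := by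
  rw [symm, sq_right]

lemma coc_B (a b c d t u : ℚ_[2]ˣ) : IsCoc a b c d (b * c * t ^ 2) (d * c * u ^ 2) := by
  unfold IsCoc
  simp only [mul_left, mul_right, sq_left, sq_right]
  simp only [self]
  simp only [symm b a, symm c a, symm d a, symm c b, symm d b, symm d c]
  generalize hilbertUnits a b = x1, hilbertUnits a c = x2, hilbertUnits a d = x3,
    hilbertUnits b c = x4, hilbertUnits b d = x5, hilbertUnits c d = x6
  simp [mul_assoc, mul_left_comm, mul_comm, cancel]

lemma coc_C (a b c f t u : ℚ_[2]ˣ) : IsCoc a b c (a * b * t ^ 2) (b * c * u ^ 2) f := by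
  unfold IsCoc
  simp only [mul_left, mul_right, sq_left, sq_right]
  simp only [self]
  simp only [symm b a, symm c a, symm f a, symm c b, symm f b, symm f c]
  generalize hilbertUnits a b = x1, hilbertUnits a c = x2, hilbertUnits a f = x3,
    hilbertUnits b c = x4, hilbertUnits b f = x5, hilbertUnits c f = x6
  simp [mul_assoc, mul_left_comm, mul_comm, cancel]

lemma coc_P (a b c e t : ℚ_[2]ˣ) :
    IsCoc a b c (-1 * a * b * t ^ 2) e (-1 * a * b * t ^ 2 * c) := by
  unfold IsCoc
  simp only [mul_left, mul_right, sq_left, sq_right]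
  simp only [self]
  simp only [symm (-1), symm b a, symm c a, symm e a, symm c b, symm e b, symm e c]
  generalize hilbertUnits a b = x1, hilbertUnits a c = x2, hilbertUnits a e = x3,
    hilbertUnits b c = x4, hilbertUnits b e = x5, hilbertUnits c e = x6
  simp [mul_assoc, mul_left_comm, mul_comm, cancel]

lemma coc_Q (a b c d t : ℚ_[2]ˣ) :
    IsCoc a b c d (-1 * b * c * t ^ 2) (a * (-1 * b * c * t ^ 2)⁻¹) := by
  unfold IsCoc
  simp only [mul_left, mul_right, inv_left, inv_right, sq_left, sq_right]
  simp only [self]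
  simp only [symm (-1), symm b a, symm c a, symm d a, symm c b, symm d b, symm d c]
  generalize hilbertUnits a b = x1, hilbertUnits a c = x2, hilbertUnits a d = x3,
    hilbertUnits b c = x4, hilbertUnits b d = x5, hilbertUnits c d = x6
  simp [mul_assoc, mul_left_comm, mul_comm, cancel]

lemma coc_R (a b c d : ℚ_[2]ˣ) : IsCoc a b c d (a * c * d⁻¹) (-1 * d * c⁻¹) := by
  unfold IsCoc
  simp only [mul_left, mul_right, inv_left, inv_right, sq_left, sq_right]
  simp only [self]
  simp only [symm (-1), symm b a, symm c a, symm d a, symm c b, symm d b, symm d c]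
  generalize hilbertUnits a b = x1, hilbertUnits a c = x2, hilbertUnits a d = x3,
    hilbertUnits b c = x4, hilbertUnits b d = x5, hilbertUnits c d = x6
  simp [mul_assoc, mul_left_comm, mul_comm, cancel]

end hilbertUnits

/-- The group `SL₂(ℚ₂)`. -/
abbrev SLQ : Type := Matrix.SpecialLinearGroup (Fin 2) ℚ_[2]

open Classical in
/-- For `g = (a b; c d)`: `x(g) = c` if `c ≠ 0`, and `x(g) = d` if `c = 0`. -/
def xEntry (g : SLQ) : ℚ_[2] := if g 1 0 ≠ 0 then g 1 0 else g 1 1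

open Classical in
/-- For `g = (a b; c d)`: `s(g) = (c, d)` if `cd ≠ 0` and `ord c` is odd, and `s(g) = 1`
otherwise. -/
def sSign (g : SLQ) : ℤˣ :=
  if g 1 0 * g 1 1 ≠ 0 ∧ Odd (g 1 0).valuation then hilbertSymbol (g 1 0) (g 1 1) else 1

/-- The cocycle `σ(g₁, g₂) = (x(g₁g₂)x(g₁), x(g₁g₂)x(g₂)) s(g₁) s(g₂) s(g₁g₂)`. -/
def cocycle (g₁ g₂ : SLQ) : ℤˣ :=
  hilbertSymbol (xEntry (g₁ * g₂) * xEntry g₁) (xEntry (g₁ * g₂) * xEntry g₂) *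
    sSign g₁ * sSign g₂ * sSign (g₁ * g₂)

namespace cocycle

lemma det (g : SLQ) : g 0 0 * g 1 1 - g 0 1 * g 1 0 = 1 := by
  rw [← Matrix.det_fin_two]; exact g.det_coe

lemma xEntry_ne_zero (g : SLQ) : xEntry g ≠ 0 := by
  unfold xEntry
  split_ifs with h
  · exact h
  · intro h'
    have := det g
    rw [not_not.1 h, h'] at this
    simp at this

lemma mul_10 (g h : SLQ) : (g * h) 1 0 = g 1 0 * h 0 0 + g 1 1 * h 1 0 := by
  simp [Matrix.SpecialLinearGroup.coe_mul, Matrix.mul_apply, Fin.sum_univ_two]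

lemma mul_11 (g h : SLQ) : (g * h) 1 1 = g 1 0 * h 0 1 + g 1 1 * h 1 1 := by
  simp [Matrix.SpecialLinearGroup.coe_mul, Matrix.mul_apply, Fin.sum_univ_two]

lemma xEntry_mul_of_left {g : SLQ} (hg : g 1 0 = 0) (h : SLQ) :
    xEntry (g * h) = xEntry g * xEntry h := by
  have h1 : g 1 1 ≠ 0 := by simpa [xEntry, hg] using xEntry_ne_zero g
  by_cases h0 : h 1 0 = 0 <;> simp [xEntry, mul_10, mul_11, hg, h0, h1]

lemma xEntry_mul_of_right (g : SLQ) {h : SLQ} (hh : h 1 0 = 0) :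
    ∃ t ≠ 0, xEntry (g * h) = xEntry g * xEntry h * t ^ 2 := by
  have h1 : h 1 1 ≠ 0 := by simpa [xEntry, hh] using xEntry_ne_zero h
  have hd := det h
  have h2 : h 0 0 ≠ 0 := by
    intro h'; rw [h', hh] at hd; simp at hd
  by_cases h0 : g 1 0 = 0
  · exact ⟨1, one_ne_zero, by simp [xEntry, mul_10, mul_11, hh, h0]⟩
  · refine ⟨h 0 0, h2, ?_⟩
    simp [xEntry, mul_10, hh, h0, h2]
    rw [hh] at hd
    linear_combination (-g 1 0 * h 0 0) * hd

/-- The main part of the cocycle identity. -/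
lemma aux (g₁ g₂ g₃ : SLQ) :
    hilbertSymbol (xEntry (g₁ * g₂) * xEntry g₁) (xEntry (g₁ * g₂) * xEntry g₂) *
      hilbertSymbol (xEntry (g₁ * g₂ * g₃) * xEntry (g₁ * g₂))
        (xEntry (g₁ * g₂ * g₃) * xEntry g₃) =
    hilbertSymbol (xEntry (g₁ * g₂ * g₃) * xEntry g₁)
        (xEntry (g₁ * g₂ * g₃) * xEntry (g₂ * g₃)) *
      hilbertSymbol (xEntry (g₂ * g₃) * xEntry g₂) (xEntry (g₂ * g₃) * xEntry g₃) := by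
  obtain ⟨a, ha⟩ : ∃ a : ℚ_[2]ˣ, (a : ℚ_[2]) = xEntry g₁ := ⟨Units.mk0 _ (xEntry_ne_zero _), rfl⟩
  obtain ⟨b, hb⟩ : ∃ a : ℚ_[2]ˣ, (a : ℚ_[2]) = xEntry g₂ := ⟨Units.mk0 _ (xEntry_ne_zero _), rfl⟩
  obtain ⟨c, hc⟩ : ∃ a : ℚ_[2]ˣ, (a : ℚ_[2]) = xEntry g₃ := ⟨Units.mk0 _ (xEntry_ne_zero _), rfl⟩
  obtain ⟨d, hd⟩ : ∃ a : ℚ_[2]ˣ, (a : ℚ_[2]) = xEntry (g₁ * g₂) :=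
    ⟨Units.mk0 _ (xEntry_ne_zero _), rfl⟩
  obtain ⟨e, he⟩ : ∃ a : ℚ_[2]ˣ, (a : ℚ_[2]) = xEntry (g₂ * g₃) :=
    ⟨Units.mk0 _ (xEntry_ne_zero _), rfl⟩
  obtain ⟨f, hf⟩ : ∃ a : ℚ_[2]ˣ, (a : ℚ_[2]) = xEntry (g₁ * g₂ * g₃) :=
    ⟨Units.mk0 _ (xEntry_ne_zero _), rfl⟩
  suffices hilbertUnits.IsCoc a b c d e f by
    rw [← ha, ← hb, ← hc, ← hd, ← he, ← hf]
    simpa [hilbertUnits.IsCoc, hilbertUnits] using this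
  by_cases h1 : g₁ 1 0 = 0
  · have e1 : d = a * b := Units.ext (by
      rw [hd, Units.val_mul, ha, hb, xEntry_mul_of_left h1])
    have e2 : f = a * e := Units.ext (by
      rw [hf, Units.val_mul, ha, he, mul_assoc, xEntry_mul_of_left h1])
    rw [e1, e2]
    exact hilbertUnits.coc_A a b c e
  by_cases h3 : g₃ 1 0 = 0
  · obtain ⟨t, ht0, ht⟩ := xEntry_mul_of_right g₂ h3
    obtain ⟨u, hu0, hu⟩ := xEntry_mul_of_right (g₁ * g₂) h3
    have e1 : e = b * c * (Units.mk0 t ht0) ^ 2 := Units.ext (by simp [he, hb, hc, ht])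
    have e2 : f = d * c * (Units.mk0 u hu0) ^ 2 := Units.ext (by simp [hf, hd, hc, hu])
    rw [e1, e2]
    exact hilbertUnits.coc_B a b c d _ _
  by_cases h2 : g₂ 1 0 = 0
  · obtain ⟨t, ht0, ht⟩ := xEntry_mul_of_right g₁ h2
    have e1 : d = a * b * (Units.mk0 t ht0) ^ 2 := Units.ext (by simp [hd, ha, hb, ht])
    have e2 : e = b * c * 1 ^ 2 := Units.ext (by simp [he, hb, hc, xEntry_mul_of_left h2])
    rw [e1, e2]
    exact hilbertUnits.coc_C a b c f _ _
  have da : (a : ℚ_[2]) = g₁ 1 0 := by rw [ha, xEntry, if_pos h1]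
  have db : (b : ℚ_[2]) = g₂ 1 0 := by rw [hb, xEntry, if_pos h2]
  have dc : (c : ℚ_[2]) = g₃ 1 0 := by rw [hc, xEntry, if_pos h3]
  have D2 := det g₂
  have D3 := det g₃
  have rel : g₂ 1 0 * (g₁ * g₂ * g₃) 1 0 + g₁ 1 0 * g₃ 1 0 = (g₁ * g₂) 1 0 * (g₂ * g₃) 1 0 := by
    simp only [mul_10, mul_11]
    linear_combination (-(g₁ 1 0) * g₃ 1 0) * D2
  by_cases h12 : (g₁ * g₂) 1 0 = 0
  · have dd : (d : ℚ_[2]) = (g₁ * g₂) 1 1 := by rw [hd, xEntry, if_neg (not_not.2 h12)]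
    have e1 : d = -1 * a * b * (b⁻¹) ^ 2 := Units.ext (by
      simp only [Units.val_mul, Units.val_neg, Units.val_one, Units.val_pow_eq_pow_val,
        Units.val_inv_eq_inv_val]
      rw [dd, da, db]
      field_simp
      rw [mul_10] at h12
      rw [mul_11]
      linear_combination (g₂ 1 1) * h12 - (g₁ 1 0) * D2)
    have e2 : f = d * c := Units.ext (by
      rw [hf, xEntry_mul_of_left h12, Units.val_mul, hd, hc])
    rw [e2, e1]
    exact hilbertUnits.coc_P a b c e _
  by_cases h23 : (g₂ * g₃) 1 0 = 0
  · have de : (e : ℚ_[2]) = (g₂ * g₃) 1 1 := by rw [he, xEntry, if_neg (not_not.2 h23)]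
    have e1 : e = -1 * b * c * (c⁻¹) ^ 2 := Units.ext (by
      simp only [Units.val_mul, Units.val_neg, Units.val_one, Units.val_pow_eq_pow_val,
        Units.val_inv_eq_inv_val]
      rw [de, db, dc]
      field_simp
      rw [mul_10] at h23
      rw [mul_11]
      linear_combination (g₃ 1 1) * h23 - (g₂ 1 0) * D3)
    have hD := det (g₂ * g₃)
    rw [h23] at hD
    have h00 : (g₂ * g₃) 0 0 ≠ 0 := by
      intro h'; rw [h'] at hD; simp at hD
    have e2 : f = a * e⁻¹ := Units.ext (by
      have : (g₁ * g₂ * g₃) 1 0 = g₁ 1 0 * (g₂ * g₃) 0 0 := by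
        rw [mul_assoc, mul_10, h23]; ring
      rw [hf, xEntry, this, if_pos (mul_ne_zero h1 h00), Units.val_mul, Units.val_inv_eq_inv_val,
        da, eq_mul_inv_iff_mul_eq₀ e.ne_zero, de]
      linear_combination (g₁ 1 0) * hD)
    rw [e2, e1]
    exact hilbertUnits.coc_Q a b c d _
  have dd : (d : ℚ_[2]) = (g₁ * g₂) 1 0 := by rw [hd, xEntry, if_pos h12]
  have de : (e : ℚ_[2]) = (g₂ * g₃) 1 0 := by rw [he, xEntry, if_pos h23]
  by_cases h123 : (g₁ * g₂ * g₃) 1 0 = 0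
  · have df : (f : ℚ_[2]) = (g₁ * g₂ * g₃) 1 1 := by rw [hf, xEntry, if_neg (not_not.2 h123)]
    rw [h123] at rel
    have e1 : e = a * c * d⁻¹ := Units.ext (by
      simp only [Units.val_mul, Units.val_inv_eq_inv_val]
      rw [eq_mul_inv_iff_mul_eq₀ d.ne_zero, de, dd, da, dc]
      linear_combination -rel)
    have e2 : f = -1 * d * c⁻¹ := Units.ext (by
      simp only [Units.val_mul, Units.val_inv_eq_inv_val, Units.val_neg, Units.val_one]
      rw [eq_mul_inv_iff_mul_eq₀ c.ne_zero, df, dd, dc]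
      rw [mul_10] at h123
      rw [mul_11]
      linear_combination (g₃ 1 1) * h123 - ((g₁ * g₂) 1 0) * D3)
    rw [e1, e2]
    exact hilbertUnits.coc_R a b c d
  have df : (f : ℚ_[2]) = (g₁ * g₂ * g₃) 1 0 := by rw [hf, xEntry, if_pos h123]
  apply hilbertUnits.coc_G
  rw [da, db, dc, dd, de, df]
  exact rel

lemma cocycle_mul (g₁ g₂ g₃ : SLQ) :
    cocycle g₁ g₂ * cocycle (g₁ * g₂) g₃ = cocycle g₁ (g₂ * g₃) * cocycle g₂ g₃ := by
  have h := aux g₁ g₂ g₃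
  unfold cocycle
  rw [← mul_assoc g₁ g₂ g₃]
  generalize hilbertSymbol (xEntry (g₁ * g₂) * xEntry g₁) (xEntry (g₁ * g₂) * xEntry g₂) = A at *
  generalize hilbertSymbol (xEntry (g₁ * g₂ * g₃) * xEntry (g₁ * g₂))
        (xEntry (g₁ * g₂ * g₃) * xEntry g₃) = B at *
  generalize hilbertSymbol (xEntry (g₁ * g₂ * g₃) * xEntry g₁)
        (xEntry (g₁ * g₂ * g₃) * xEntry (g₂ * g₃)) = C at *
  generalize hilbertSymbol (xEntry (g₂ * g₃) * xEntry g₂) (xEntry (g₂ * g₃) * xEntry g₃) = D at *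
  obtain rfl : A = C * D * B := by rw [← h, mul_assoc, Int.units_mul_self, mul_one]
  generalize sSign (g₁ * g₂ * g₃) = s1, sSign (g₁ * g₂) = s2, sSign (g₂ * g₃) = s3,
    sSign g₁ = s4, sSign g₂ = s5, sSign g₃ = s6
  simp [mul_assoc, mul_left_comm, mul_comm, hilbertUnits.cancel]

lemma sSign_one : sSign 1 = 1 := by simp [sSign]

lemma xEntry_one : xEntry 1 = 1 := by simp [xEntry]

lemma symbol_sq (a b : ℚ_[2]) (hb : b ≠ 0) : hilbertSymbol a (b * b) = 1 :=
  hilbertSymbol.eq_one 0 b⁻¹ 1 (Or.inr (Or.inr one_ne_zero)) (by field_simp; ring)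

lemma one_left (g : SLQ) : cocycle 1 g = 1 := by
  unfold cocycle
  rw [one_mul, sSign_one, symbol_sq _ _ (xEntry_ne_zero g), mul_one, one_mul, Int.units_mul_self]

lemma one_right (g : SLQ) : cocycle g 1 = 1 := by
  unfold cocycle
  rw [mul_one, sSign_one, hilbertSymbol.symm, symbol_sq _ _ (xEntry_ne_zero g), mul_one, one_mul,
    Int.units_mul_self]

/-- Left and right cocycle values at `-1` agree. -/
lemma neg_one_comm (g : SLQ) : cocycle (-1) g = cocycle g (-1) := by
  unfold cocycle
  rw [neg_one_mul, mul_neg_one, hilbertSymbol.symm, mul_right_comm _ (sSign (-1))]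

end cocycle
/-- The two-fold central extension `G` of `SL₂(ℚ₂)`: the set `SL₂(ℚ₂) × {±1}` with the
multiplication `(g₁, ε₁)(g₂, ε₂) = (g₁g₂, ε₁ε₂σ(g₁, g₂))`. -/
@[ext]
structure Cover where
  toSL : SLQ
  sign : ℤˣ

namespace Cover

instance : Mul Cover := ⟨fun p q => ⟨p.toSL * q.toSL, p.sign * q.sign * cocycle p.toSL q.toSL⟩⟩
instance : One Cover := ⟨⟨1, 1⟩⟩
instance : Inv Cover := ⟨fun p => ⟨p.toSL⁻¹, p.sign * cocycle p.toSL⁻¹ p.toSL⟩⟩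

lemma mul_def (p q : Cover) :
    p * q = ⟨p.toSL * q.toSL, p.sign * q.sign * cocycle p.toSL q.toSL⟩ := rfl
lemma one_def : (1 : Cover) = ⟨1, 1⟩ := rfl
lemma inv_def (p : Cover) : p⁻¹ = ⟨p.toSL⁻¹, p.sign * cocycle p.toSL⁻¹ p.toSL⟩ := rfl

instance : Group Cover :=
  Group.ofLeftAxioms
    (by
      intro p q r
      simp only [mul_def]
      ext1
      · exact mul_assoc _ _ _
      · have h := cocycle.cocycle_mul p.toSL q.toSL r.toSL
        calc p.sign * q.sign * cocycle p.toSL q.toSL * r.sign * cocycle (p.toSL * q.toSL) r.toSL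
            = p.sign * q.sign * r.sign *
                (cocycle p.toSL q.toSL * cocycle (p.toSL * q.toSL) r.toSL) := by
              simp only [mul_assoc, mul_left_comm, mul_comm]
          _ = _ := by rw [h]; simp only [mul_assoc, mul_left_comm, mul_comm])
    (by
      intro p
      simp only [mul_def, one_def, one_mul, cocycle.one_left, mul_one])
    (by
      intro p
      simp only [mul_def, one_def, inv_def, inv_mul_cancel]
      congr 1
      rw [mul_assoc (p.sign * _), Int.units_mul_self])

/-- The projection `G → SL₂(ℚ₂)`. -/
def proj : Cover →* SLQ where
  toFun := toSL
  map_one' := rfl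
  map_mul' _ _ := rfl

/-- The element `h(-1) = (-1, 1)` of `G`. -/
def hNegOne : Cover := ⟨-1, 1⟩

/-- The element `w(1) = ((0 1; -1 0), 1)` of `G`. -/
def wOne : Cover := ⟨⟨Matrix.of ![![0, 1], ![-1, 0]], by simp [Matrix.det_fin_two_of]⟩, 1⟩

/-- The nontrivial element `(1, -1)` of the central subgroup `μ₂` of `G`. -/
def negSign : Cover := ⟨1, -1⟩

lemma hNegOne_mem_center : hNegOne ∈ Subgroup.center Cover := by
  rw [Subgroup.mem_center_iff]
  intro p
  simp only [mul_def, hNegOne, cocycle.neg_one_comm, mul_one, one_mul, neg_one_mul, mul_neg_one]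

lemma negSign_mem_center : negSign ∈ Subgroup.center Cover := by
  rw [Subgroup.mem_center_iff]
  intro p
  simp only [mul_def, negSign, cocycle.one_left, cocycle.one_right, mul_one, one_mul, neg_one_mul,
    mul_neg_one]

/-- The inclusion of `SL₂(ℤ₂)` in `SL₂(ℚ₂)`. -/
def incl : Matrix.SpecialLinearGroup (Fin 2) ℤ_[2] →* SLQ :=
  Matrix.SpecialLinearGroup.map PadicInt.Coe.ringHom

/-- `K(2ⁿ)` for `n ≥ 2`: the image under the section `g ↦ (g, 1)` of the principal congruence
subgroup of level `2ⁿ` of `SL₂(ℤ₂)`. -/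
def principal (n : ℕ) : Set Cover :=
  {p | p.sign = 1 ∧ ∃ m : Matrix.SpecialLinearGroup (Fin 2) ℤ_[2], incl m = p.toSL ∧
    (2 : ℤ_[2]) ^ n ∣ m 0 0 - 1 ∧ (2 : ℤ_[2]) ^ n ∣ m 0 1 ∧
    (2 : ℤ_[2]) ^ n ∣ m 1 0 ∧ (2 : ℤ_[2]) ^ n ∣ m 1 1 - 1}

lemma principal_anti {m n : ℕ} (h : m ≤ n) : principal n ⊆ principal m := by
  rintro p ⟨hp, x, hx, h1, h2, h3, h4⟩
  have := pow_dvd_pow (2 : ℤ_[2]) h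
  exact ⟨hp, x, hx, this.trans h1, this.trans h2, this.trans h3, this.trans h4⟩

/-- The topology of `G`, for which the subgroups `K(2ⁿ)`, `n ≥ 2`, are a basis of neighbourhoods
of the identity and left translations are homeomorphisms. (It is not the product topology of
`SL₂(ℚ₂) × {±1}`: the section is not continuous everywhere.) -/
instance : TopologicalSpace Cover where
  IsOpen U := ∀ p ∈ U, ∃ n ≥ 2, ∀ k ∈ principal n, p * k ∈ U
  isOpen_univ := fun _ _ => ⟨2, le_rfl, fun _ _ => trivial⟩
  isOpen_inter := by
    intro U V hU hV p hp
    obtain ⟨n, hn, h1⟩ := hU p hp.1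
    obtain ⟨m, -, h2⟩ := hV p hp.2
    exact ⟨max n m, le_max_of_le_left hn, fun k hk =>
      ⟨h1 k (principal_anti (le_max_left _ _) hk), h2 k (principal_anti (le_max_right _ _) hk)⟩⟩
  isOpen_sUnion := by
    intro S hS p hp
    obtain ⟨U, hU, hpU⟩ := hp
    obtain ⟨n, hn, h⟩ := hS U hU p hpU
    exact ⟨n, hn, fun k hk => ⟨U, hU, h k hk⟩⟩

/-- `K`: the full inverse image of `SL₂(ℤ₂)` in `G`. -/
def K : Subgroup Cover := incl.range.comap proj

/-- The subgroup of `SL₂(ℤ₂)` of the matrices `(a b; c d)` with `c ∈ 4ℤ₂`. -/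
def Gamma04 : Subgroup (Matrix.SpecialLinearGroup (Fin 2) ℤ_[2]) where
  carrier := {m | (4 : ℤ_[2]) ∣ m 1 0}
  one_mem' := by simp
  mul_mem' := by
    intro m m' h h'
    have : (m * m') 1 0 = m 1 0 * m' 0 0 + m 1 1 * m' 1 0 := by
      simp [Matrix.SpecialLinearGroup.coe_mul, Matrix.mul_apply, Fin.sum_univ_two]
    change (4 : ℤ_[2]) ∣ (m * m') 1 0
    rw [this]
    exact dvd_add (Dvd.dvd.mul_right h _) (Dvd.dvd.mul_left h' _)
  inv_mem' := by
    intro m h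
    change (4 : ℤ_[2]) ∣ m⁻¹ 1 0
    simpa [Matrix.SpecialLinearGroup.coe_inv, Matrix.adjugate_fin_two] using h

/-- `K₀`: the full inverse image in `G` of the matrices in `SL₂(ℤ₂)` with `c ∈ 4ℤ₂`. -/
def K0 : Subgroup Cover := (Gamma04.map incl).comap proj

/-- `K₁ = K₁(4)`: the elements `((a b; c d), 1)` with `(a b; c d) ∈ SL₂(ℤ₂)`, `a ∈ 1 + 4ℤ₂` and
`c ∈ 4ℤ₂`. -/
def K1 : Set Cover :=
  {p | p.sign = 1 ∧ ∃ m : Matrix.SpecialLinearGroup (Fin 2) ℤ_[2], incl m = p.toSL ∧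
    (4 : ℤ_[2]) ∣ m 0 0 - 1 ∧ (4 : ℤ_[2]) ∣ m 1 0}

/-- `K₀` as a subgroup of `K`. -/
def K0inK : Subgroup K := K0.subgroupOf K

instance : Gamma04.FiniteIndex := by
  have : NeZero (2 ^ 2 : ℕ) := ⟨by norm_num⟩
  let r : Matrix.SpecialLinearGroup (Fin 2) ℤ_[2] →* Matrix.SpecialLinearGroup (Fin 2) (ZMod (2 ^ 2)) :=
    Matrix.SpecialLinearGroup.map (PadicInt.toZModPow 2)
  have : Finite (Matrix.SpecialLinearGroup (Fin 2) (ZMod (2 ^ 2))) := by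
    unfold Matrix.SpecialLinearGroup; infer_instance
  have : r.ker.FiniteIndex := inferInstance
  refine Subgroup.finiteIndex_of_le (H := r.ker) ?_
  intro m hm
  have h : (r m) 1 0 = 0 := by rw [MonoidHom.mem_ker.1 hm]; simp
  have h' : m 1 0 ∈ RingHom.ker (PadicInt.toZModPow (p := 2) 2) := h
  rw [PadicInt.ker_toZModPow, Ideal.mem_span_singleton] at h'
  norm_num at h'
  exact h'

instance : K0inK.FiniteIndex := by
  constructor
  have hinj : Function.Injective incl := by
    intro m m' h
    ext i j
    have := congrArg (fun t : SLQ => t i j) h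
    exact Subtype.ext this
  have hp : Function.Surjective proj := fun g => ⟨⟨g, 1⟩, rfl⟩
  have : K0inK.index = Gamma04.index := by
    change K0.relIndex K = _
    rw [K0, Subgroup.relIndex_comap, K, Subgroup.map_comap_eq_self_of_surjective hp,
      MonoidHom.range_eq_map, Subgroup.relIndex_map_map_of_injective _ _ hinj,
      Subgroup.relIndex_top_right]
  rw [this]
  exact Subgroup.FiniteIndex.index_ne_zero

end Cover

open Cover

/-- A character `γ` of the center of `G` is genuine if `μ₂` acts faithfully through it. -/
def IsGenuine (γ : Subgroup.center Cover →* ℂˣ) : Prop := γ ⟨negSign, negSign_mem_center⟩ = -1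

open Classical in
/-- The extension of `γ` to `K₀ = M × K₁`, `M` the center of `G`, which is trivial on `K₁`:
`γ(m k) = γ(m)` for `m ∈ M`, `k ∈ K₁` (and `0` outside `K₀`). -/
def extChar (γ : Subgroup.center Cover →* ℂˣ) (g : Cover) : ℂ :=
  if h : ∃ m : Subgroup.center Cover, ∃ k ∈ K1, g = m * k then (γ h.choose : ℂ) else 0

/-- `ζ = (1 + γ(h(-1))) / √2`. -/
def zeta (γ : Subgroup.center Cover →* ℂˣ) : ℂ :=
  (1 + (γ ⟨hNegOne, hNegOne_mem_center⟩ : ℂ)) / (Real.sqrt 2 : ℂ)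

open Classical in
/-- The function `X` on `G` supported on `K₀ g K₀` with
`X(k g k') = conj (γ(k)) * conj c * conj (γ(k'))` for `k, k' ∈ K₀`, where `c` is the value `γ(g)`. -/
def heckeFn (γ : Subgroup.center Cover →* ℂˣ) (g : Cover) (c : ℂ) (x : Cover) : ℂ :=
  if h : ∃ p : K0 × K0, x = p.1 * g * p.2 then
    star (extChar γ h.choose.1) * star c * star (extChar γ h.choose.2)
  else 0

/-- `T_w = X_w / √2 ∈ H(γ)`, where `w = w(1)` and `γ(w) = ζ`. -/
def Tw (γ : Subgroup.center Cover →* ℂˣ) (x : Cover) : ℂ :=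
  heckeFn γ wOne (zeta γ) x / (Real.sqrt 2 : ℂ)

/-- `F₂ = (T_w + 1) / 3`, where the unit `1` of `H(γ)` is the function supported on `K₀` and equal
to the conjugate of `γ` there. -/
def F2 (γ : Subgroup.center Cover →* ℂˣ) (x : Cover) : ℂ := (Tw γ x + heckeFn γ 1 1 x) / 3

/-- `F̂₂(g) = F₂(g⁻¹)`, a function supported on `K`. -/
def F2hat (γ : Subgroup.center Cover →* ℂˣ) (x : Cover) : ℂ := F2 γ x⁻¹

section Rep

variable {V : Type*} [AddCommGroup V] [Module ℂ V]

/-- A representation of `G` is smooth if the stabilizer of every vector is open. -/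
def IsSmooth (π : Representation ℂ Cover V) : Prop := ∀ v : V, IsOpen {g : Cover | π g v = v}

/-- The center of `G` acts by the character `γ`. -/
def HasCentralCharacter (π : Representation ℂ Cover V) (γ : Subgroup.center Cover →* ℂˣ) : Prop :=
  ∀ (m : Subgroup.center Cover) (v : V), π m v = (γ m : ℂ) • v

/-- `V^γ = {v : π(k) v = γ(k) v for all k ∈ K₀}`. -/
def gammaVectors (γ : Subgroup.center Cover →* ℂˣ) (π : Representation ℂ Cover V) :
    Submodule ℂ V where
  carrier := {v | ∀ k ∈ K0, π k v = extChar γ k • v}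
  zero_mem' := by simp
  add_mem' := by
    intro v w hv hw k hk
    rw [map_add, hv k hk, hw k hk, smul_add]
  smul_mem' := by
    intro c v hv k hk
    rw [map_smul, hv k hk, smul_comm]

/-- `π(f) v = ∫_G f(g) π(g) v dg`, where the Haar measure `dg` gives `K₀` the measure `1`, for
`f ∈ H(γ)` and `v ∈ V^γ`: the integrand is then right `K₀`-invariant and supported on finitely many
cosets `g K₀`, each of measure `1`, so that the integral is the sum of its values over `G / K₀`. -/
def heckeAct (π : Representation ℂ Cover V) (f : Cover → ℂ) (v : V) : V :=
  ∑ᶠ q : Cover ⧸ K0, f q.out • π q.out v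

/-- A `γ`-spherical vector: an eigenvector of `T_w` in `V^γ` with eigenvalue `2`. -/
def IsSpherical (γ : Subgroup.center Cover →* ℂˣ) (π : Representation ℂ Cover V) (v : V) : Prop :=
  v ∈ gammaVectors γ π ∧ v ≠ 0 ∧ heckeAct π (Tw γ) v = (2 : ℂ) • v

/-- A `γ`-unramified representation: one that contains a `γ`-spherical vector. -/
def IsUnramified (γ : Subgroup.center Cover →* ℂˣ) (π : Representation ℂ Cover V) : Prop :=
  ∃ v : V, IsSpherical γ π v

/-- The restriction to `K` of a representation of `G`. -/
def restrictK (π : Representation ℂ Cover V) : Representation ℂ K V := π.comp K.subtype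

end Rep

/-- The action `π_R` of `K` by right translation on functions on `K`. -/
def piR : Representation ℂ K (K → ℂ) where
  toFun k :=
    { toFun := fun φ x => φ (x * k)
      map_add' := fun _ _ => rfl
      map_smul' := fun _ _ => rfl }
  map_one' := by ext φ x; simp
  map_mul' k k' := by
    refine LinearMap.ext fun φ => funext fun x => ?_
    change φ (x * (k * k')) = φ (x * k * k')
    rw [mul_assoc]

/-- The induced representation `I_K(γ)`: the functions `φ` on `K` with `φ(k₀ k) = γ(k₀) φ(k)` for
`k₀ ∈ K₀`, `k ∈ K`. -/
def IK (γ : Subgroup.center Cover →* ℂˣ) : Submodule ℂ (K → ℂ) where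
  carrier := {φ | ∀ k₀ : K, (k₀ : Cover) ∈ K0 → ∀ k : K, φ (k₀ * k) = extChar γ k₀ * φ k}
  zero_mem' := by simp
  add_mem' := by
    intro φ ψ hφ hψ k₀ h k
    simp only [Pi.add_apply, hφ k₀ h k, hψ k₀ h k, mul_add]
  smul_mem' := by
    intro c φ hφ k₀ h k
    simp only [Pi.smul_apply, smul_eq_mul, hφ k₀ h k, mul_left_comm]

/-- `(π_L(f) φ)(g) = ∫_K f(k) φ(k⁻¹ g) dk` for `φ ∈ I_K(γ)` and `f` in the Hecke algebra
`H_K` of the conjugate of `γ`: again the integrand is right `K₀`-invariant in `k` and `K₀` has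
measure `1`, so that the integral is the sum over the finite set `K / K₀`. -/
def piL (f : Cover → ℂ) : (K → ℂ) →ₗ[ℂ] (K → ℂ) where
  toFun φ g := ∑ᶠ q : K ⧸ K0inK, f q.out * φ (q.out⁻¹ * g)
  map_add' φ ψ := by
    funext g
    simp only [Pi.add_apply, mul_add]
    exact finsum_add_distrib (Set.toFinite _) (Set.toFinite _)
  map_smul' c φ := by
    funext g
    simp only [Pi.smul_apply, smul_eq_mul, RingHom.id_apply, mul_finsum, mul_left_comm]

/-- The `K`-representation `V(2) = π_L(F̂₂) I_K(γ)`, with `K` acting by right translation. -/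
def V2 (γ : Subgroup.center Cover →* ℂˣ) : Subrepresentation piR where
  toSubmodule := (IK γ).map (piL (F2hat γ))
  apply_mem_toSubmodule := by
    rintro k _ ⟨φ, hφ, rfl⟩
    refine ⟨piR k φ, fun k₀ h x => ?_, ?_⟩
    · change φ (k₀ * x * k) = extChar γ k₀ * φ (x * k)
      rw [mul_assoc, hφ k₀ h]
    · funext g
      change ∑ᶠ q : K ⧸ K0inK, F2hat γ q.out * φ (q.out⁻¹ * g * k) =
        ∑ᶠ q : K ⧸ K0inK, F2hat γ q.out * φ (q.out⁻¹ * (g * k))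
      simp only [mul_assoc]

/-- The action of `K` on `V(2)`. -/
abbrev V2rep (γ : Subgroup.center Cover →* ℂˣ) : Representation ℂ K (V2 γ).toSubmodule :=
  (V2 γ).toRepresentation

/-- `F̂₂` as a function on `K`. -/
def F2hatK (γ : Subgroup.center Cover →* ℂˣ) : K → ℂ := fun k => F2hat γ k

end

end DyadicCover

/-! Write i = γ(h(-1)) and n = n(1). In the cover h(-1)² = (1, -1), because (-1, -1) = -1, so i² =
-1 for genuine γ. The function F̂₂ transforms by γ under K₀ on both sides, hence is determined by
its values on K₀\K, a copy of the projective line over ℤ/4 with representatives 1, w nʲ (0 ≤ j < 4)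
and w n² w. These values are 1/3, (1 + i)/6 (four times) and 0. Comparing values on the six cosets
gives the identity on which everything rests, `F2hat_nElt_wOne`: under right translation, n w F̂₂ =
F̂₂ + i w F̂₂.

It follows that the span of F̂₂ and w F̂₂ is K-stable (`piR_F2hatK_mem_span`). Convolution with F̂₂
produces combinations of right translates of F̂₂ (`piL_F2hat_apply`), and F̂₂ is itself such a
convolution, so this span is V(2) (`V2_eq_span`). On it n is diagonalizable with the distinct
eigenvalues 1 and i, and w preserves neither eigenline, whence irreducibility.

Let l be a nonzero K-map on V(2) and v = l(F̂₂). Since K₀wK₀ is the union of the cosets nʲ w K₀, T_w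
v is (1 - i)/2 times the sum of the nʲ w v, and the three-term relation turns this into 2v
(`isSpherical_apply_F2hatK`). Conversely, for a spherical v, Frobenius reciprocity sends φ to ∫
φ(k⁻¹) π(k) v dk; it maps F̂₂ to (v + T_w v)/3 = v, so it is nonzero on V(2) (`frobenius_F2hatK`).

For γ and T_w to be well defined, the cover must split over Γ₁(4) by m ↦ (m, 1) (`cocycle_eq_one`),
and γ must be compatible with conjugation by w (`extChar_eq_of_mul_wOne`). Both come from Hilbert
symbol identities, chiefly (a, b) = 1 for a + b = 1. The values of F̂₂ at w nʲ w come from `braid`,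
a relation of SL₂(ℤ) that lifts to the cover without a sign. -/

namespace DyadicCover

noncomputable section

/-! ### Divisibility in `ℤ₂` -/

lemma pow_two_dvd_iff (n : ℕ) (x : ℤ_[2]) :
    (2 : ℤ_[2]) ^ n ∣ x ↔ PadicInt.toZModPow (p := 2) n x = 0 := by
  rw [← RingHom.mem_ker, PadicInt.ker_toZModPow, Ideal.mem_span_singleton]
  norm_num

lemma four_dvd_iff (x : ℤ_[2]) : (4 : ℤ_[2]) ∣ x ↔ PadicInt.toZModPow (p := 2) 2 x = 0 := by
  rw [← pow_two_dvd_iff]; norm_num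

lemma two_dvd_iff (x : ℤ_[2]) : (2 : ℤ_[2]) ∣ x ↔ PadicInt.toZModPow (p := 2) 1 x = 0 := by
  rw [← pow_two_dvd_iff]; norm_num

lemma isUnit_or_two_dvd (x : ℤ_[2]) : IsUnit x ∨ (2 : ℤ_[2]) ∣ x := by
  by_cases h : IsUnit x
  · exact Or.inl h
  · rw [PadicInt.not_isUnit_iff, PadicInt.norm_lt_one_iff_dvd] at h
    exact Or.inr (by exact_mod_cast h)

lemma not_isUnit_of_two_dvd {x : ℤ_[2]} (h : (2 : ℤ_[2]) ∣ x) : ¬ IsUnit x := by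
  rw [PadicInt.not_isUnit_iff, PadicInt.norm_lt_one_iff_dvd]
  exact_mod_cast h

lemma two_dvd_of_four_dvd {x : ℤ_[2]} (h : (4 : ℤ_[2]) ∣ x) : (2 : ℤ_[2]) ∣ x :=
  Dvd.dvd.trans ⟨2, by norm_num⟩ h

lemma two_dvd_add_of_isUnit {x y : ℤ_[2]} (hx : IsUnit x) (hy : IsUnit y) :
    (2 : ℤ_[2]) ∣ x + y := by
  have key : ∀ a b : ZMod (2 ^ 1), IsUnit a → IsUnit b → a + b = 0 := by decide
  rw [two_dvd_iff, map_add]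
  exact key _ _ (hx.map _) (hy.map _)

lemma isUnit_of_four_dvd_sub_one {x : ℤ_[2]} (h : (4 : ℤ_[2]) ∣ x - 1) : IsUnit x := by
  refine (isUnit_or_two_dvd x).resolve_right fun h2 => ?_
  have h1 : (2 : ℤ_[2]) ∣ 1 := by
    simpa using dvd_sub h2 (two_dvd_of_four_dvd h)
  exact not_isUnit_of_two_dvd h1 isUnit_one

lemma four_dvd_mul_sub_one {x y : ℤ_[2]} (hx : (4 : ℤ_[2]) ∣ x - 1) (hy : (4 : ℤ_[2]) ∣ y - 1) :
    (4 : ℤ_[2]) ∣ x * y - 1 := by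
  have : x * y - 1 = (x - 1) * y + (y - 1) := by ring
  rw [this]
  exact dvd_add (Dvd.dvd.mul_right hx _) hy

lemma exists_four_dvd_sub (x : ℤ_[2]) : ∃ j : Fin 4, (4 : ℤ_[2]) ∣ x - ((j : ℕ) : ℤ_[2]) := by
  have key : ∀ a : ZMod (2 ^ 2), ∃ j : Fin 4, a - ((j : ℕ) : ZMod (2 ^ 2)) = 0 := by decide
  obtain ⟨j, hj⟩ := key (PadicInt.toZModPow (p := 2) 2 x)
  exact ⟨j, by rw [four_dvd_iff, map_sub, map_natCast, hj]⟩

lemma eq_of_four_dvd_sub {i j : Fin 4} (h : (4 : ℤ_[2]) ∣ ((i : ℕ) : ℤ_[2]) - ((j : ℕ) : ℤ_[2])) :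
    i = j := by
  have key : ∀ i j : Fin 4, ((i : ℕ) : ZMod (2 ^ 2)) - ((j : ℕ) : ZMod (2 ^ 2)) = 0 → i = j := by
    decide
  rw [four_dvd_iff, map_sub, map_natCast, map_natCast] at h
  exact key i j h

lemma four_dvd_sub_one_or_add_one {x : ℤ_[2]} (hx : IsUnit x) :
    (4 : ℤ_[2]) ∣ x - 1 ∨ (4 : ℤ_[2]) ∣ x + 1 := by
  have key : ∀ a : ZMod (2 ^ 2), IsUnit a → a - 1 = 0 ∨ a + 1 = 0 := by decide
  rw [four_dvd_iff, four_dvd_iff, map_sub, map_add, map_one]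
  exact key _ (hx.map _)

lemma not_four_dvd_two : ¬ (4 : ℤ_[2]) ∣ 2 := by
  rw [four_dvd_iff, map_ofNat]
  decide

/-! ### Values of the Hilbert symbol -/

namespace hilbertSymbol

lemma mul_left' (a b c : ℚ_[2]) (ha : a ≠ 0) (hb : b ≠ 0) (hc : c ≠ 0) :
    hilbertSymbol (a * b) c = hilbertSymbol a c * hilbertSymbol b c := by
  rw [symm, mul_right' c a b hc ha hb, symm c a, symm c b]

lemma of_eight_dvd (a : ℚ_[2]) {d : ℤ_[2]} (h : (8 : ℤ_[2]) ∣ d - 1) :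
    hilbertSymbol a d = 1 := by
  obtain ⟨z, hz⟩ := exists_sq_of_dvd d h
  refine eq_one 0 1 (z : ℚ_[2]) (Or.inr (Or.inl one_ne_zero)) ?_
  rw [← PadicInt.coe_pow, hz]; ring

/-- Either `d` is 1 modulo 8, hence a square, or `d + 4u` is; in the second case its square root `z`
solves `z² = u·2² + d·1²`. -/
lemma of_isUnit {u d : ℤ_[2]} (hu : IsUnit u) (hd : (4 : ℤ_[2]) ∣ d - 1) :
    hilbertSymbol u d = 1 := by
  obtain ⟨t, ht⟩ := hd
  have h8 : (8 : ℤ_[2]) = 4 * 2 := by norm_num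
  rcases isUnit_or_two_dvd t with h | h
  · obtain ⟨z, hz⟩ := exists_sq_of_dvd (d + 4 * u) (by
      have : d + 4 * u - 1 = 4 * (t + u) := by linear_combination ht
      rw [this, h8]
      exact mul_dvd_mul_left _ (two_dvd_add_of_isUnit h hu))
    refine eq_one 2 1 (z : ℚ_[2]) (Or.inr (Or.inl one_ne_zero)) ?_
    rw [← PadicInt.coe_pow, hz]
    push_cast
    have h4 : ((4 : ℤ_[2]) : ℚ_[2]) = 4 := rfl
    rw [h4]; ring
  · apply of_eight_dvd
    rw [ht, h8]
    exact mul_dvd_mul_left _ h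

/-- For even `t` the second argument is 1 modulo 8. For a unit `t`, write `c = (-ct)(-t⁻¹)`: the
first factor and `1 + ct` add up to 1, and the second is a unit, paired with an element that is 1
modulo 4. -/
lemma one_add_mul {c : ℤ_[2]} (hc : (4 : ℤ_[2]) ∣ c) (t : ℤ_[2]) :
    hilbertSymbol c (1 + c * t : ℤ_[2]) = 1 := by
  rcases isUnit_or_two_dvd t with h | h
  · rcases eq_or_ne c 0 with rfl | h0
    · exact of_eight_dvd _ (by simp)
    have hd : (4 : ℤ_[2]) ∣ (1 + c * t) - 1 := by simpa using Dvd.dvd.mul_right hc t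
    have hne : ((1 + c * t : ℤ_[2]) : ℚ_[2]) ≠ 0 :=
      PadicInt.coe_ne_zero.2 (isUnit_of_four_dvd_sub_one hd).ne_zero
    obtain ⟨s, hs⟩ := h.exists_right_inv
    have hsu : IsUnit (-s) := (IsUnit.of_mul_eq_one (b := t) (by rw [mul_comm]; exact hs)).neg
    have e : (c : ℚ_[2]) = ((-(c * t) : ℤ_[2]) : ℚ_[2]) * ((-s : ℤ_[2]) : ℚ_[2]) := by
      rw [← PadicInt.coe_mul]
      exact congrArg (fun r : ℤ_[2] => (r : ℚ_[2])) (by linear_combination (-c) * hs)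
    have hct : ((-(c * t) : ℤ_[2]) : ℚ_[2]) ≠ 0 :=
      PadicInt.coe_ne_zero.2 (neg_ne_zero.2 (mul_ne_zero h0 h.ne_zero))
    rw [e, mul_left' _ _ _ hct (PadicInt.coe_ne_zero.2 hsu.ne_zero) hne, of_isUnit hsu hd, mul_one]
    apply of_add_eq_one
    push_cast; ring
  · apply of_eight_dvd
    have h8 : (8 : ℤ_[2]) = 4 * 2 := by norm_num
    rw [add_sub_cancel_left, h8]
    exact mul_dvd_mul hc h

lemma neg_one_neg_one : hilbertSymbol (-1) (-1) = -1 := by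
  have := rep_symbol_nat 1 0 0 1 0 0
  simpa [rep] using this

end hilbertSymbol

namespace hilbertUnits

/-- The Hilbert symbol identity behind the splitting of the cover over `Γ₁(4)`. -/
lemma split (x y z d e f : ℚ_[2]ˣ) (hef : hilbertUnits e f = 1)
    (he : hilbertUnits e (-1) = 1)
    (hx : hilbertUnits x (d * e * f) = 1) (h : (x + y * f : ℚ_[2]) = e * z) :
    hilbertUnits (z * x) (z * y) * hilbertUnits x d * hilbertUnits y e * hilbertUnits z f = 1 := by
  -- Divided by `e z`, the relation `h` says that two elements have sum 1, so their symbol is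
  -- trivial; expanding it bilinearly gives the claim.
  have S : hilbertUnits (x * e⁻¹ * z⁻¹) (y * f * e⁻¹ * z⁻¹) = 1 := by
    apply hilbertSymbol.of_add_eq_one
    push_cast
    field_simp
    linear_combination h
  simp only [mul_left, mul_right, inv_left, inv_right] at S hx ⊢
  rw [← S]
  rw [mul_eq_one_iff_eq_inv, Int.units_inv_eq_self] at hx
  simp only [self, he, hef, symm e x, symm e y, symm e z, symm y x, symm z x, symm z y, hx.symm]
  generalize hilbertUnits x y = x1, hilbertUnits x z = x2, hilbertUnits x d = x3,
    hilbertUnits x e = x4,  hilbertUnits y z = x6, hilbertUnits y e = x7,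
    hilbertUnits z e = x8, hilbertUnits z f = x9, hilbertUnits z (-1) = y1
  simp [mul_assoc, mul_left_comm, mul_comm, cancel]

end hilbertUnits

open Cover

/-- The group `SL₂(ℤ₂)`. -/
abbrev SLZ : Type := Matrix.SpecialLinearGroup (Fin 2) ℤ_[2]

/-! ### The cocycle on Γ₁(4) and at the matrix W -/

namespace SLZ

lemma det (m : SLZ) : m 0 0 * m 1 1 - m 0 1 * m 1 0 = 1 := by
  rw [← Matrix.det_fin_two]; exact m.det_coe

lemma mul_apply (m m' : SLZ) (i j : Fin 2) :
    (m * m') i j = m i 0 * m' 0 j + m i 1 * m' 1 j := by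
  simp [Matrix.SpecialLinearGroup.coe_mul, Matrix.mul_apply, Fin.sum_univ_two]

lemma incl_apply (m : SLZ) (i j : Fin 2) : incl m i j = (m i j : ℚ_[2]) := rfl

lemma incl_injective : Function.Injective incl := by
  intro m m' h
  ext i j
  exact Subtype.ext (congrArg (fun t : SLQ => t i j) h)

/-- The matrices in `Γ₁(4)`. -/
def IsGammaOne (m : SLZ) : Prop := (4 : ℤ_[2]) ∣ m 0 0 - 1 ∧ (4 : ℤ_[2]) ∣ m 1 0

namespace IsGammaOne

variable {m m' : SLZ}

lemma four_dvd_d (h : IsGammaOne m) : (4 : ℤ_[2]) ∣ m 1 1 - 1 := by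
  have : m 1 1 - 1 = m 0 1 * m 1 0 - (m 0 0 - 1) * m 1 1 := by linear_combination det m
  rw [this]
  exact dvd_sub (Dvd.dvd.mul_left h.2 _) (Dvd.dvd.mul_right h.1 _)

lemma mul (h : IsGammaOne m) (h' : IsGammaOne m') : IsGammaOne (m * m') := by
  refine ⟨?_, ?_⟩
  · have : (m * m') 0 0 - 1 = (m 0 0 * m' 0 0 - 1) + m 0 1 * m' 1 0 := by
      rw [mul_apply]; ring
    rw [this]
    exact dvd_add (four_dvd_mul_sub_one h.1 h'.1) (Dvd.dvd.mul_left h'.2 _)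
  · rw [mul_apply]
    exact dvd_add (Dvd.dvd.mul_right h.2 _) (Dvd.dvd.mul_left h'.2 _)

lemma isUnit_d (h : IsGammaOne m) : IsUnit (m 1 1) := isUnit_of_four_dvd_sub_one h.four_dvd_d

lemma d_ne_zero (h : IsGammaOne m) : (m 1 1 : ℚ_[2]) ≠ 0 :=
  PadicInt.coe_ne_zero.2 h.isUnit_d.ne_zero

end IsGammaOne

lemma xEntry_of_ne_zero {m : SLZ} (h : m 1 0 ≠ 0) : xEntry (incl m) = m 1 0 := by
  rw [xEntry, if_pos]
  · rfl
  · exact PadicInt.coe_ne_zero.2 h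

lemma xEntry_of_eq_zero {m : SLZ} (h : m 1 0 = 0) : xEntry (incl m) = m 1 1 := by
  rw [xEntry, if_neg]
  · rfl
  · rw [not_not, incl_apply, h]; rfl

lemma sSign_of_isUnit {m : SLZ} (h : IsUnit (m 1 0)) : sSign (incl m) = 1 := by
  rw [sSign, if_neg]
  rintro ⟨-, h2⟩
  rw [incl_apply, PadicInt.valuation_coe] at h2
  have : (m 1 0).valuation = 0 := by
    have h1 := PadicInt.norm_eq_zpow_neg_valuation h.ne_zero
    rw [PadicInt.isUnit_iff.1 h] at h1
    by_contra hne
    have : ((2 : ℕ) : ℝ) ^ (-((m 1 0).valuation : ℤ)) < 1 :=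
      zpow_lt_one_of_neg₀ (by norm_num) (by omega)
    exact absurd h1.symm this.ne
  rw [this] at h2
  simp at h2

/-- An even power of 2 is a square, so `c` may be replaced by its unit part. -/
lemma hilbertSymbol_of_even_valuation {c d : ℤ_[2]} (hc : c ≠ 0)
    (h : ¬ Odd (c : ℚ_[2]).valuation) (hd : (4 : ℤ_[2]) ∣ d - 1) : hilbertSymbol c d = 1 := by
  rw [PadicInt.valuation_coe, Int.odd_coe_nat, Nat.not_odd_iff_even] at h
  obtain ⟨k, hk⟩ := h
  have e : (c : ℚ_[2]) = (2 ^ k) ^ 2 * ((PadicInt.unitCoeff hc : ℤ_[2]) : ℚ_[2]) := by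
    conv_lhs => rw [PadicInt.unitCoeff_spec hc, hk]
    have h2 : ((2 : ℤ_[2]) : ℚ_[2]) = 2 := rfl
    push_cast
    rw [h2]
    ring
  rw [e, hilbertSymbol.mul_sq_left _ _ _ (pow_ne_zero _ two_ne_zero)]
  exact hilbertSymbol.of_isUnit (Units.isUnit _) hd

namespace IsGammaOne

variable {m m' : SLZ}

/-- On Γ₁(4) the case distinction in the definition of s disappears: where s is 1 by convention, the
symbol is 1 as well because d is 1 modulo 4. -/
lemma sSign_eq (h : IsGammaOne m) :
    sSign (incl m) = hilbertSymbol (xEntry (incl m)) (m 1 1) := by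
  by_cases h0 : m 1 0 = 0
  · rw [xEntry_of_eq_zero h0, hilbertSymbol.of_isUnit h.isUnit_d h.four_dvd_d, sSign, if_neg]
    rw [incl_apply, h0]
    simp
  · rw [xEntry_of_ne_zero h0, sSign]
    split_ifs with h1
    · rfl
    · rw [hilbertSymbol_of_even_valuation h0 _ h.four_dvd_d]
      exact fun h2 => h1 ⟨mul_ne_zero (PadicInt.coe_ne_zero.2 h0) h.d_ne_zero, h2⟩

/-- The uniform formula for s makes this an identity of symbols in the bottom rows (c, d), (c', d'),
(c'', d'') of the two factors and their product. If c, c', c'' are all nonzero, `split` applies to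
the relation c + c'd'' = d'c''. If one of them vanishes, x takes the lower right entry there and the
identity is checked directly. -/
lemma cocycle_eq_one (h : IsGammaOne m) (h' : IsGammaOne m') :
    cocycle (incl m) (incl m') = 1 := by
  have h'' := h.mul h'
  unfold cocycle
  rw [← map_mul, h.sSign_eq, h'.sSign_eq, h''.sSign_eq]
  obtain ⟨x, hx⟩ : ∃ a : ℚ_[2]ˣ, (a : ℚ_[2]) = xEntry (incl m) :=
    ⟨Units.mk0 _ (cocycle.xEntry_ne_zero _), rfl⟩
  obtain ⟨y, hy⟩ : ∃ a : ℚ_[2]ˣ, (a : ℚ_[2]) = xEntry (incl m') :=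
    ⟨Units.mk0 _ (cocycle.xEntry_ne_zero _), rfl⟩
  obtain ⟨z, hz⟩ : ∃ a : ℚ_[2]ˣ, (a : ℚ_[2]) = xEntry (incl (m * m')) :=
    ⟨Units.mk0 _ (cocycle.xEntry_ne_zero _), rfl⟩
  obtain ⟨d, hd⟩ : ∃ a : ℚ_[2]ˣ, (a : ℚ_[2]) = m 1 1 := ⟨Units.mk0 _ h.d_ne_zero, rfl⟩
  obtain ⟨e, he⟩ : ∃ a : ℚ_[2]ˣ, (a : ℚ_[2]) = m' 1 1 := ⟨Units.mk0 _ h'.d_ne_zero, rfl⟩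
  obtain ⟨f, hf⟩ : ∃ a : ℚ_[2]ˣ, (a : ℚ_[2]) = (m * m') 1 1 := ⟨Units.mk0 _ h''.d_ne_zero, rfl⟩
  have hdd : hilbertUnits d d = 1 := by
    unfold hilbertUnits; rw [hd]; exact hilbertSymbol.of_isUnit h.isUnit_d h.four_dvd_d
  have hde : hilbertUnits d e = 1 := by
    unfold hilbertUnits; rw [hd, he]; exact hilbertSymbol.of_isUnit h.isUnit_d h'.four_dvd_d
  have hee : hilbertUnits e e = 1 := by
    unfold hilbertUnits; rw [he]; exact hilbertSymbol.of_isUnit h'.isUnit_d h'.four_dvd_d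
  have hef : hilbertUnits e f = 1 := by
    unfold hilbertUnits; rw [he, hf]; exact hilbertSymbol.of_isUnit h'.isUnit_d h''.four_dvd_d
  have hff : hilbertUnits f f = 1 := by
    unfold hilbertUnits; rw [hf]; exact hilbertSymbol.of_isUnit h''.isUnit_d h''.four_dvd_d
  have he1 : hilbertUnits e (-1) = 1 := by rw [← hilbertUnits.self, hee]
  have hf1 : hilbertUnits f (-1) = 1 := by rw [← hilbertUnits.self, hff]
  have hmul : (m * m') 1 1 = m 1 0 * m' 0 1 + m 1 1 * m' 1 1 := mul_apply _ _ _ _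
  suffices hilbertUnits (z * x) (z * y) * hilbertUnits x d * hilbertUnits y e *
      hilbertUnits z f = 1 by
    rw [← hx, ← hy, ← hz, ← hd, ← he, ← hf]
    simpa [hilbertUnits] using this
  by_cases h0 : m 1 0 = 0
  · have hxd : x = d := Units.ext (by rw [hx, hd, xEntry_of_eq_zero h0])
    have hz' : z = d * y := Units.ext (by
      rw [hz, map_mul, cocycle.xEntry_mul_of_left, Units.val_mul, ← hx, ← hy, hxd]
      rw [incl_apply, h0]; rfl)
    have hf' : f = d * e := Units.ext (by
      rw [hf, hmul, h0, Units.val_mul, hd, he]; simp)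
    rw [hf', hz', hxd]
    have hd1 : hilbertUnits d (-1) = 1 := by rw [← hilbertUnits.self, hdd]
    simp only [hilbertUnits.mul_left, hilbertUnits.mul_right, hdd, hde, hilbertUnits.self,
      hilbertUnits.symm y d, hilbertUnits.symm e d, hd1]
    simp [mul_assoc, mul_left_comm, mul_comm, hilbertUnits.cancel]
  have hx0 : (x : ℚ_[2]) = m 1 0 := by rw [hx, xEntry_of_ne_zero h0]
  -- Up to the square of d d', the product d d' d'' is 1 + c b'/(d d'), with b' the upper right
  -- entry of `m'`, so that `one_add_mul` applies.
  have key : hilbertUnits x (d * e * f) = 1 := by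
    unfold hilbertUnits
    have hu := (h.isUnit_d.mul h'.isUnit_d)
    obtain ⟨s, hs⟩ := hu.exists_right_inv
    have e1 : ((d * e * f : ℚ_[2]ˣ) : ℚ_[2]) =
        (d * e : ℚ_[2]) ^ 2 * ((1 + m 1 0 * (m' 0 1 * s) : ℤ_[2]) : ℚ_[2]) := by
      have : m 1 1 * m' 1 1 * (m * m') 1 1 =
          (m 1 1 * m' 1 1) ^ 2 * (1 + m 1 0 * (m' 0 1 * s)) := by
        rw [hmul]
        linear_combination (- m 1 1 * m' 1 1 * m 1 0 * m' 0 1) * hs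
      have := congrArg (fun r : ℤ_[2] => (r : ℚ_[2])) this
      push_cast at this ⊢
      rw [hd, he, hf]
      exact this
    rw [e1, hilbertSymbol.mul_sq_right _ _ _ (mul_ne_zero d.ne_zero e.ne_zero), hx0]
    exact hilbertSymbol.one_add_mul h.2 _
  by_cases h0' : m' 1 0 = 0
  · have hye : y = e := Units.ext (by rw [hy, he, xEntry_of_eq_zero h0'])
    obtain ⟨t, ht, ht'⟩ := cocycle.xEntry_mul_of_right (incl m) (h := incl m')
      (by rw [incl_apply, h0']; rfl)
    have hz' : z = x * e * (Units.mk0 t ht) ^ 2 := Units.ext (by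
      rw [hz, map_mul, ht', ← hx, ← hy, hye]; simp)
    rw [hye, hz']
    simp only [hilbertUnits.mul_left, hilbertUnits.mul_right, hilbertUnits.sq_left,
      hilbertUnits.sq_right, hilbertUnits.self, he1, hef, hilbertUnits.symm e x] at key ⊢
    rw [mul_eq_one_iff_eq_inv, Int.units_inv_eq_self] at key
    rw [← key]
    simp [mul_assoc, mul_left_comm, mul_comm, hilbertUnits.cancel]
  have hy0 : (y : ℚ_[2]) = m' 1 0 := by rw [hy, xEntry_of_ne_zero h0']
  have rel : m 1 0 + m' 1 0 * (m * m') 1 1 = m' 1 1 * (m * m') 1 0 := by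
    rw [hmul, mul_apply]
    linear_combination (-m 1 0) * det m'
  by_cases h0'' : (m * m') 1 0 = 0
  · have hzf : z = f := Units.ext (by rw [hz, hf, xEntry_of_eq_zero h0''])
    have hx' : x = -1 * y * f := Units.ext (by
      have : m 1 0 = -1 * m' 1 0 * (m * m') 1 1 := by
        linear_combination rel + m' 1 1 * h0''
      simp only [Units.val_mul, Units.val_neg, Units.val_one]
      rw [hx0, hy0, hf, this]
      push_cast
      rfl)
    have hfd : hilbertUnits f d = 1 := by
      unfold hilbertUnits; rw [hf, hd]; exact hilbertSymbol.of_isUnit h''.isUnit_d h.four_dvd_d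
    have h1d : hilbertUnits (-1) d = 1 := by
      rw [hilbertUnits.symm, ← hilbertUnits.self, hdd]
    rw [hx'] at key
    rw [hzf, hx']
    simp only [hilbertUnits.mul_left, hilbertUnits.mul_right, hilbertUnits.self, he1, hf1, hef,
      hfd, hff, h1d, hilbertUnits.symm (-1) e, hilbertUnits.symm (-1) f, hilbertUnits.symm f e,
      hilbertUnits.symm f y, hilbertUnits.symm (-1) y] at key ⊢
    simp only [mul_one, one_mul] at key ⊢
    rw [mul_eq_one_iff_eq_inv, Int.units_inv_eq_self] at key
    rw [← key]
    simp [mul_assoc, mul_left_comm, mul_comm, hilbertUnits.cancel]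
  have hz0 : (z : ℚ_[2]) = (m * m') 1 0 := by rw [hz, xEntry_of_ne_zero h0'']
  apply hilbertUnits.split _ _ _ _ _ _ hef he1 key
  rw [hx0, hy0, hz0, he, hf]
  exact congrArg (fun r : ℤ_[2] => (r : ℚ_[2])) rel

end IsGammaOne

/-- The matrix `(0 1; -1 0)`. -/
def W : SLZ := ⟨Matrix.of ![![0, 1], ![-1, 0]], by simp [Matrix.det_fin_two_of]⟩

/-- The matrix `(1 x; 0 1)`. -/
def N (x : ℤ_[2]) : SLZ := ⟨Matrix.of ![![1, x], ![0, 1]], by simp [Matrix.det_fin_two_of]⟩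

@[simp] lemma W_00 : W 0 0 = 0 := rfl
@[simp] lemma W_01 : W 0 1 = 1 := rfl
@[simp] lemma W_10 : W 1 0 = -1 := rfl
@[simp] lemma W_11 : W 1 1 = 0 := rfl
@[simp] lemma N_00 (x : ℤ_[2]) : N x 0 0 = 1 := rfl
@[simp] lemma N_01 (x : ℤ_[2]) : N x 0 1 = x := rfl
@[simp] lemma N_10 (x : ℤ_[2]) : N x 1 0 = 0 := rfl
@[simp] lemma N_11 (x : ℤ_[2]) : N x 1 1 = 1 := rfl

lemma ext_entries {m m' : SLZ} (h00 : m 0 0 = m' 0 0) (h01 : m 0 1 = m' 0 1)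
    (h10 : m 1 0 = m' 1 0) (h11 : m 1 1 = m' 1 1) : m = m' := by
  ext i j
  fin_cases i <;> fin_cases j <;> assumption

lemma N_add (x y : ℤ_[2]) : N (x + y) = N x * N y := by
  apply ext_entries <;> simp [mul_apply, add_comm]

lemma isGammaOne_N (x : ℤ_[2]) : IsGammaOne (N x) := by simp [IsGammaOne]

lemma isGammaOne_one : IsGammaOne 1 := by simp [IsGammaOne]

namespace IsGammaOne

variable {m : SLZ}

/-- The product has lower left entry -d, so with x = x(m) the cocycle is (-dx, d)(x, d) = (-d, d) =
1. -/
lemma cocycle_W_right (h : IsGammaOne m) : cocycle (incl m) (incl W) = 1 := by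
  have hd := h.isUnit_d
  have e : (m * W) 1 0 = -m 1 1 := by simp [mul_apply]
  have hx : xEntry (incl (m * W)) = ((-m 1 1 : ℤ_[2]) : ℚ_[2]) := by
    rw [xEntry_of_ne_zero, e]
    rw [e]; exact neg_ne_zero.2 hd.ne_zero
  have hW : xEntry (incl W) = -1 := by
    rw [xEntry_of_ne_zero] <;> simp
  have hd0 := h.d_ne_zero
  have hx0 := cocycle.xEntry_ne_zero (incl m)
  unfold cocycle
  rw [← map_mul, sSign_of_isUnit (m := W) (by simp), sSign_of_isUnit (m := m * W)
    (by rw [e]; exact hd.neg), h.sSign_eq, hx, hW, mul_one, mul_one, PadicInt.coe_neg,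
    neg_mul_neg, mul_one, hilbertSymbol.mul_left' _ _ _ (neg_ne_zero.2 hd0) hx0 hd0,
    hilbertSymbol.symm (-_), hilbertSymbol.neg_self, one_mul, Int.units_mul_self]

/-- With x = x(m) the cocycle is (a, -ax)(x, d) = (x, a)(x, d). For c ≠ 0 this is (c, 1 + bc) = 1;
for c = 0 all entries of the symbols are 1 modulo 4. -/
lemma cocycle_W_left (h : IsGammaOne m) : cocycle (incl W) (incl m) = 1 := by
  have ha := isUnit_of_four_dvd_sub_one h.1
  have e : (W * m) 1 0 = -m 0 0 := by simp [mul_apply]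
  have hx : xEntry (incl (W * m)) = ((-m 0 0 : ℤ_[2]) : ℚ_[2]) := by
    rw [xEntry_of_ne_zero, e]
    rw [e]; exact neg_ne_zero.2 ha.ne_zero
  have hW : xEntry (incl W) = -1 := by
    rw [xEntry_of_ne_zero] <;> simp
  have hd0 := h.d_ne_zero
  have ha0 : (m 0 0 : ℚ_[2]) ≠ 0 := PadicInt.coe_ne_zero.2 ha.ne_zero
  have hx0 := cocycle.xEntry_ne_zero (incl m)
  have key : hilbertSymbol (xEntry (incl m)) (m 0 0) * hilbertSymbol (xEntry (incl m)) (m 1 1)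
      = 1 := by
    by_cases h0 : m 1 0 = 0
    · rw [xEntry_of_eq_zero h0, hilbertSymbol.of_isUnit h.isUnit_d h.four_dvd_d,
        hilbertSymbol.of_isUnit h.isUnit_d h.1, one_mul]
    · rw [xEntry_of_ne_zero h0, ← hilbertSymbol.mul_right' _ _ _ (PadicInt.coe_ne_zero.2 h0) ha0
        hd0, ← PadicInt.coe_mul]
      have : m 0 0 * m 1 1 = 1 + m 1 0 * m 0 1 := by linear_combination det m
      rw [this]
      exact hilbertSymbol.one_add_mul h.2 _
  unfold cocycle
  rw [← map_mul, sSign_of_isUnit (m := W) (by simp), sSign_of_isUnit (m := W * m)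
    (by rw [e]; exact ha.neg), h.sSign_eq, hx, hW, mul_one, mul_one, PadicInt.coe_neg,
    neg_mul_neg, mul_one, hilbertSymbol.mul_right' _ _ _ ha0 (neg_ne_zero.2 ha0) hx0,
    hilbertSymbol.neg_self, one_mul, hilbertSymbol.symm _ (xEntry _), key]

end IsGammaOne

end SLZ

/-! ### Elements of the cover and the relations between them -/

namespace Cover

/-- The section `m ↦ (m, 1)` of the cover over `SL₂(ℤ₂)`. -/
def lift (m : SLZ) : Cover := ⟨incl m, 1⟩

/-- The element `((1 x; 0 1), 1)` of `G`. -/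
def nElt (x : ℤ_[2]) : Cover := lift (SLZ.N x)

lemma lift_mul_lift (m m' : SLZ) :
    lift m * lift m' = ⟨incl (m * m'), cocycle (incl m) (incl m')⟩ := by
  simp [lift, mul_def]

lemma mem_K1_iff {p : Cover} : p ∈ K1 ↔ ∃ m, SLZ.IsGammaOne m ∧ p = lift m := by
  constructor
  · rintro ⟨h1, m, hm, h⟩
    exact ⟨m, h, Cover.ext hm.symm h1⟩
  · rintro ⟨m, h, rfl⟩
    exact ⟨rfl, m, rfl, h⟩

lemma mem_K0_iff {p : Cover} : p ∈ K0 ↔ ∃ m : SLZ, (4 : ℤ_[2]) ∣ m 1 0 ∧ incl m = p.toSL :=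
  Iff.rfl

lemma mem_K_iff {p : Cover} : p ∈ K ↔ ∃ m : SLZ, incl m = p.toSL := Iff.rfl

lemma mem_K0_of_incl {p : Cover} {m : SLZ} (h : p.toSL = incl m) :
    p ∈ K0 ↔ (4 : ℤ_[2]) ∣ m 1 0 := by
  rw [mem_K0_iff]
  constructor
  · rintro ⟨m', h1, h2⟩
    rwa [← SLZ.incl_injective (h2.trans h)]
  · exact fun h1 => ⟨m, h1, h.symm⟩

lemma K0_le_K : K0 ≤ K := by
  intro p hp
  obtain ⟨m, -, hm⟩ := mem_K0_iff.1 hp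
  exact ⟨m, hm⟩

lemma K1_subset_K0 : K1 ⊆ K0 := by
  intro p hp
  obtain ⟨m, hm, rfl⟩ := mem_K1_iff.1 hp
  exact ⟨m, hm.2, rfl⟩

lemma mul_mem_K1 {p q : Cover} (hp : p ∈ K1) (hq : q ∈ K1) : p * q ∈ K1 := by
  obtain ⟨m, hm, rfl⟩ := mem_K1_iff.1 hp
  obtain ⟨m', hm', rfl⟩ := mem_K1_iff.1 hq
  exact mem_K1_iff.2 ⟨m * m', hm.mul hm', by
    rw [lift_mul_lift, hm.cocycle_eq_one hm']; rfl⟩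

lemma one_eq_lift : (1 : Cover) = lift 1 := by
  rw [one_def, lift, map_one]

lemma one_mem_K1 : (1 : Cover) ∈ K1 := mem_K1_iff.2 ⟨1, SLZ.isGammaOne_one, one_eq_lift⟩

lemma nElt_mem_K1 (x : ℤ_[2]) : nElt x ∈ K1 := mem_K1_iff.2 ⟨_, SLZ.isGammaOne_N x, rfl⟩

lemma nElt_add (x y : ℤ_[2]) : nElt (x + y) = nElt x * nElt y := by
  unfold nElt
  rw [lift_mul_lift, (SLZ.isGammaOne_N x).cocycle_eq_one (SLZ.isGammaOne_N y), SLZ.N_add]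
  rfl

lemma nElt_zero : nElt 0 = 1 := by
  have := nElt_add 0 0
  rwa [add_zero, left_eq_mul] at this

lemma nElt_neg (x : ℤ_[2]) : nElt (-x) = (nElt x)⁻¹ := by
  rw [eq_inv_iff_mul_eq_one, ← nElt_add, neg_add_cancel, nElt_zero]

lemma nElt_natCast (j : ℕ) : nElt j = nElt 1 ^ j := by
  induction j with
  | zero => simp [nElt_zero]
  | succ j ih => rw [Nat.cast_succ, nElt_add, ih, pow_succ]

lemma wOne_eq_lift : wOne = lift SLZ.W := by
  refine Cover.ext ?_ rfl
  ext i j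
  fin_cases i <;> fin_cases j <;> rfl

lemma toSL_mul (p q : Cover) : (p * q).toSL = p.toSL * q.toSL := rfl
lemma toSL_inv (p : Cover) : (p⁻¹).toSL = p.toSL⁻¹ := rfl
lemma toSL_lift (m : SLZ) : (lift m).toSL = incl m := rfl
lemma toSL_nElt (x : ℤ_[2]) : (nElt x).toSL = incl (SLZ.N x) := rfl
lemma toSL_wOne : wOne.toSL = incl SLZ.W := by rw [wOne_eq_lift, toSL_lift]

lemma one_symbol (a : ℚ_[2]) : hilbertSymbol 1 a = 1 :=
  hilbertSymbol.eq_one 1 0 1 (Or.inl one_ne_zero) (by ring)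

lemma incl_eq_neg_one {m : SLZ} (h00 : m 0 0 = -1) (h01 : m 0 1 = 0)
    (h10 : m 1 0 = 0) (h11 : m 1 1 = -1) : incl m = -1 := by
  ext i j
  rw [SLZ.incl_apply]
  fin_cases i <;> fin_cases j <;> simp [h00, h01, h10, h11]

lemma xEntry_neg_one : xEntry (-1) = -1 := by simp [xEntry]

lemma sSign_neg_one : sSign (-1) = 1 := by simp [sSign]

lemma wOne_mul_wOne : wOne * wOne = hNegOne := by
  rw [wOne_eq_lift, lift_mul_lift, hNegOne]
  have h : incl (SLZ.W * SLZ.W) = -1 := by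
    apply incl_eq_neg_one <;> simp [SLZ.mul_apply]
  have hx : xEntry (incl SLZ.W) = -1 := by
    rw [SLZ.xEntry_of_ne_zero] <;> simp
  congr 1
  unfold cocycle
  rw [← map_mul, h, xEntry_neg_one, sSign_neg_one, SLZ.sSign_of_isUnit (m := SLZ.W) (by simp), hx]
  simp [one_symbol]

/-- The sign is the symbol (-1, -1) = -1. This is what forces γ(h(-1)) to be a square root of -1 for
genuine γ. -/
lemma hNegOne_mul_hNegOne : hNegOne * hNegOne = negSign := by
  rw [mul_def, hNegOne, negSign]
  simp only [neg_mul_neg, mul_one, one_mul]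
  congr 1
  unfold cocycle
  simp [xEntry_neg_one, sSign_neg_one, cocycle.sSign_one, cocycle.xEntry_one,
    hilbertSymbol.neg_one_neg_one]

/-- The matrix identity holds in SL₂(ℤ). It lifts without a sign: products of W with unipotents on
one side have trivial cocycle, and in the two remaining products every s is 1 and the symbol has
first argument (-1)(-1) = 1. -/
lemma braid : nElt 1 * wOne * nElt 1 = wOne * nElt (-1) * wOne := by
  rw [mul_assoc wOne, wOne_eq_lift, nElt, nElt, lift_mul_lift, lift_mul_lift,
    (SLZ.isGammaOne_N _).cocycle_W_right, (SLZ.isGammaOne_N _).cocycle_W_right]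
  change lift _ * lift _ = lift _ * lift _
  rw [lift_mul_lift, lift_mul_lift]
  have e : SLZ.N 1 * SLZ.W * SLZ.N 1 = SLZ.W * (SLZ.N (-1) * SLZ.W) := by
    apply SLZ.ext_entries <;> simp [SLZ.mul_apply]
  have x1 : xEntry (incl (SLZ.N 1 * SLZ.W)) = -1 := by
    rw [SLZ.xEntry_of_ne_zero] <;> simp [SLZ.mul_apply]
  have x2 : xEntry (incl (SLZ.N (-1) * SLZ.W)) = -1 := by
    rw [SLZ.xEntry_of_ne_zero] <;> simp [SLZ.mul_apply]
  have x3 : xEntry (incl (SLZ.N 1 * SLZ.W * SLZ.N 1)) = -1 := by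
    rw [SLZ.xEntry_of_ne_zero] <;> simp [SLZ.mul_apply]
  have x4 : xEntry (incl SLZ.W) = -1 := by
    rw [SLZ.xEntry_of_ne_zero] <;> simp
  have x5 : xEntry (incl (SLZ.N 1)) = 1 := by
    rw [SLZ.xEntry_of_eq_zero] <;> simp
  have s1 : sSign (incl (SLZ.N 1 * SLZ.W)) = 1 :=
    SLZ.sSign_of_isUnit (by simp [SLZ.mul_apply])
  have s2 : sSign (incl (SLZ.N (-1) * SLZ.W)) = 1 :=
    SLZ.sSign_of_isUnit (by simp [SLZ.mul_apply])
  have s3 : sSign (incl (SLZ.N 1 * SLZ.W * SLZ.N 1)) = 1 :=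
    SLZ.sSign_of_isUnit (by simp [SLZ.mul_apply])
  have s4 : sSign (incl SLZ.W) = 1 := SLZ.sSign_of_isUnit (by simp)
  have s5 : sSign (incl (SLZ.N 1)) = 1 := by
    rw [(SLZ.isGammaOne_N 1).sSign_eq, x5, one_symbol]
  have c1 : cocycle (incl (SLZ.N 1 * SLZ.W)) (incl (SLZ.N 1)) = 1 := by
    unfold cocycle
    rw [← map_mul, x1, x3, x5, s1, s3, s5]
    simp [one_symbol]
  have c2 : cocycle (incl SLZ.W) (incl (SLZ.N (-1) * SLZ.W)) = 1 := by
    unfold cocycle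
    rw [← map_mul, ← e, x2, x3, x4, s2, s3, s4]
    simp [one_symbol]
  rw [c1, c2, e]

/-! ### The center -/

/-- A scalar matrix of determinant 1 is ±1; conversely all lifts of ±1 are central because the
cocycle is symmetric there. -/
lemma mem_center_iff {p : Cover} :
    p ∈ Subgroup.center Cover ↔ p.toSL = 1 ∨ p.toSL = -1 := by
  constructor
  · intro hp
    have h : p.toSL ∈ Subgroup.center SLQ := by
      rw [Subgroup.mem_center_iff] at hp ⊢
      exact fun g => congrArg toSL (hp ⟨g, 1⟩)
    obtain ⟨r, hr, h⟩ := Matrix.SpecialLinearGroup.mem_center_iff.1 h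
    rw [Fintype.card_fin, sq_eq_one_iff] at hr
    rcases hr with rfl | rfl
    · left
      apply Subtype.ext
      rw [← h]; simp
    · right
      apply Subtype.ext
      rw [← h]
      ext i j
      fin_cases i <;> fin_cases j <;> simp
  · intro hp
    rw [Subgroup.mem_center_iff]
    intro q
    rcases hp with hp | hp
    · simp only [mul_def, hp, cocycle.one_left, cocycle.one_right, mul_one, one_mul,
        mul_comm q.sign]
    · simp only [mul_def, hp, cocycle.neg_one_comm, neg_one_mul, mul_neg_one, mul_comm q.sign]

/-- The entry a is a unit, hence ±1 modulo 4, and this sign is moved into the center. -/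
lemma exists_center_mul {p : Cover} (hp : p ∈ K0) :
    ∃ m : Subgroup.center Cover, ∃ k ∈ K1, p = m * k := by
  obtain ⟨m, h4, hm⟩ := mem_K0_iff.1 hp
  have hu : IsUnit (m 0 0) := by
    refine (isUnit_or_two_dvd _).resolve_right fun h => not_isUnit_of_two_dvd ?_ isUnit_one
    rw [← SLZ.det m]
    exact dvd_sub (Dvd.dvd.mul_right h _) (Dvd.dvd.mul_left (two_dvd_of_four_dvd h4) _)
  rcases four_dvd_sub_one_or_add_one hu with h | h
  · refine ⟨⟨⟨1, p.sign⟩, mem_center_iff.2 (Or.inl rfl)⟩, lift m, mem_K1_iff.2 ⟨m, ⟨h, h4⟩, rfl⟩, ?_⟩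
    ext1
    · simp [mul_def, lift, hm]
    · simp [mul_def, lift, cocycle.one_left]
  · have hneg : SLZ.IsGammaOne (-m) := by
      constructor
      · have : (-m) 0 0 - 1 = -(m 0 0 + 1) := by
          simp; ring
        rw [this]; exact (dvd_neg).2 h
      · simpa using h4
    have hincl : incl (-m) = -p.toSL := by
      rw [← hm]
      ext i j
      simp [SLZ.incl_apply]
    refine ⟨⟨⟨-1, p.sign * cocycle (-1) (incl (-m))⟩, mem_center_iff.2 (Or.inr rfl)⟩, lift (-m),
      mem_K1_iff.2 ⟨-m, hneg, rfl⟩, ?_⟩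
    ext1
    · simp [mul_def, lift, hincl]
    · simp [mul_def, lift, mul_assoc, Int.units_mul_self]

/-- Two elements of Γ₁(4) cannot be negatives of each other, since -1 is not 1 modulo 4. -/
lemma center_mul_unique {m m' : Subgroup.center Cover} {k k' : Cover} (hk : k ∈ K1) (hk' : k' ∈ K1)
    (h : (m : Cover) * k = m' * k') : m = m' := by
  obtain ⟨a, ha, rfl⟩ := mem_K1_iff.1 hk
  obtain ⟨b, hb, rfl⟩ := mem_K1_iff.1 hk'
  have key (a b : SLZ) (ha : SLZ.IsGammaOne a) (hb : SLZ.IsGammaOne b) : incl a ≠ -incl b := by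
    intro hab
    have h00 : a 0 0 = -b 0 0 := by
      apply Subtype.ext
      have := congrArg (fun t : SLQ => t 0 0) hab
      simpa [SLZ.incl_apply] using this
    apply not_four_dvd_two
    have : (2 : ℤ_[2]) = -((a 0 0 - 1) + (b 0 0 - 1)) := by rw [h00]; ring
    rw [this]
    exact (dvd_neg).2 (dvd_add ha.1 hb.1)
  have hab : incl a = incl b := by
    have h1 : (m : Cover).toSL * incl a = (m' : Cover).toSL * incl b := congrArg toSL h
    rcases mem_center_iff.1 m.2 with e | e <;> rcases mem_center_iff.1 m'.2 with e' | e' <;>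
      rw [e, e'] at h1
    · simpa using h1
    · exact absurd (by simpa using h1) (key a b ha hb)
    · exact absurd (by simpa using h1.symm) (key b a hb ha)
    · simpa using h1
  rw [SLZ.incl_injective hab] at h
  exact Subtype.ext (mul_right_cancel h)

lemma center_le_K0 : Subgroup.center Cover ≤ K0 := by
  intro p hp
  rcases mem_center_iff.1 hp with h | h
  · exact mem_K0_iff.2 ⟨1, by simp, by rw [h, map_one]⟩
  · refine mem_K0_iff.2 ⟨-1, by simp, ?_⟩
    rw [h]
    exact incl_eq_neg_one (by simp) (by simp) (by simp) (by simp)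

/-- Conjugation by `w` maps `K₁ ∩ w K₀ w⁻¹` to `K₁`. -/
lemma mem_K1_of_mul_wOne {p q : Cover} (hp : p ∈ K1) (hq : q ∈ K0) (h : p * wOne = wOne * q) :
    q ∈ K1 := by
  obtain ⟨m, hm, rfl⟩ := mem_K1_iff.1 hp
  obtain ⟨m', h4, hm'⟩ := mem_K0_iff.1 hq
  have e : m * SLZ.W = SLZ.W * m' := by
    apply SLZ.incl_injective
    rw [map_mul, map_mul, hm', ← toSL_wOne]
    exact congrArg toSL h
  have hm1 : SLZ.IsGammaOne m' := by
    refine ⟨?_, h4⟩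
    have : (m * SLZ.W) 1 0 = (SLZ.W * m') 1 0 := by rw [e]
    simp [SLZ.mul_apply] at this
    rw [← this]
    exact hm.four_dvd_d
  refine mem_K1_iff.2 ⟨m', hm1, ?_⟩
  -- So far `q` is known only up to its sign component; the trivial cocycles at W on both sides show
  -- that it is 1.
  have h1 : wOne * q = wOne * lift m' := by
    rw [← h, wOne_eq_lift, lift_mul_lift, lift_mul_lift, hm.cocycle_W_right, hm1.cocycle_W_left, e]
  exact mul_left_cancel h1

/-! ### Cosets of `K₀` in `K` -/

lemma nElt_mem_K (x : ℤ_[2]) : nElt x ∈ K := ⟨_, rfl⟩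

lemma wOne_mem_K : wOne ∈ K := ⟨SLZ.W, toSL_wOne.symm⟩

/-- A coset is a point of the projective line over ℤ/4, read off from the bottom row (c, d): a unit
c gives j = d/c modulo 4, c in 4ℤ₂ gives K₀ itself, and c = 2 modulo 4 gives the last coset. -/
lemma exists_mem_K0_mul {p : Cover} (hp : p ∈ K) :
    p ∈ K0 ∨ (∃ j : Fin 4, ∃ k ∈ K0, p = k * (wOne * nElt 1 ^ (j : ℕ))) ∨
      ∃ k ∈ K0, p = k * (wOne * nElt 1 ^ 2 * wOne) := by
  obtain ⟨m, hm⟩ := mem_K_iff.1 hp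
  rcases isUnit_or_two_dvd (m 1 0) with h | h
  · right; left
    obtain ⟨s, hs⟩ := h.exists_right_inv
    obtain ⟨j, hj⟩ := exists_four_dvd_sub (m 1 1 * s)
    refine ⟨j, p * (wOne * nElt 1 ^ (j : ℕ))⁻¹, ?_, (inv_mul_cancel_right _ _).symm⟩
    rw [mem_K0_of_incl (m := m * (SLZ.W * SLZ.N j)⁻¹) (by
      rw [← nElt_natCast]
      simp only [toSL_mul, toSL_inv, toSL_wOne, toSL_nElt, ← hm, map_mul, map_inv])]
    have : (m * (SLZ.W * SLZ.N j)⁻¹) 1 0 = m 1 0 * (m 1 1 * s - j) := by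
      rw [mul_inv_rev]
      simp [SLZ.mul_apply, Matrix.SpecialLinearGroup.coe_inv, Matrix.adjugate_fin_two]
      linear_combination (-m 1 1) * hs
    rw [this]
    exact Dvd.dvd.mul_left hj _
  by_cases h4 : (4 : ℤ_[2]) ∣ m 1 0
  · exact Or.inl (mem_K0_iff.2 ⟨m, h4, hm⟩)
  right; right
  refine ⟨p * (wOne * nElt 1 ^ 2 * wOne)⁻¹, ?_, (inv_mul_cancel_right _ _).symm⟩
  rw [mem_K0_of_incl (m := m * (SLZ.W * SLZ.N (2 : ℕ) * SLZ.W)⁻¹) (by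
      rw [← nElt_natCast]
      simp only [toSL_mul, toSL_inv, toSL_wOne, toSL_nElt, ← hm, map_mul, map_inv])]
  have hd : IsUnit (m 1 1) := by
    refine (isUnit_or_two_dvd _).resolve_right fun h' => not_isUnit_of_two_dvd ?_ isUnit_one
    rw [← SLZ.det m]
    exact dvd_sub (Dvd.dvd.mul_left h' _) (Dvd.dvd.mul_left h _)
  obtain ⟨c, hc⟩ := h
  have hcu : IsUnit c := by
    refine (isUnit_or_two_dvd _).resolve_right fun ⟨t, ht⟩ => h4 ⟨t, ?_⟩
    rw [hc, ht]; ring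
  have : (m * (SLZ.W * SLZ.N (2 : ℕ) * SLZ.W)⁻¹) 1 0 = -2 * (c + m 1 1) := by
    rw [mul_inv_rev, mul_inv_rev]
    simp [SLZ.mul_apply, Matrix.SpecialLinearGroup.coe_inv, Matrix.adjugate_fin_two]
    linear_combination -hc
  rw [this]
  obtain ⟨t, ht⟩ := two_dvd_add_of_isUnit hcu hd
  exact ⟨-t, by rw [ht]; ring⟩

lemma wOne_conj_mem_K0 : wOne * nElt 1 ^ 4 * wOne⁻¹ ∈ K0 := by
  rw [← nElt_natCast, mem_K0_of_incl (m := SLZ.W * SLZ.N (4 : ℕ) * SLZ.W⁻¹) (by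
      simp only [toSL_mul, toSL_inv, toSL_wOne, toSL_nElt, map_mul, map_inv])]
  simp [SLZ.mul_apply, Matrix.SpecialLinearGroup.coe_inv, Matrix.adjugate_fin_two]

lemma not_mem_K0_wOne_conj : wOne * nElt 1 ^ 2 * wOne ∉ K0 := by
  rw [← nElt_natCast, mem_K0_of_incl (m := SLZ.W * SLZ.N (2 : ℕ) * SLZ.W) (by
      simp only [toSL_mul, toSL_inv, toSL_wOne, toSL_nElt, map_mul, map_inv])]
  simp [SLZ.mul_apply, not_four_dvd_two]

lemma not_mem_K0_wOne_mul (x : ℤ_[2]) : wOne * nElt x ∉ K0 := by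
  rw [mem_K0_of_incl (m := SLZ.W * SLZ.N x) (by
      simp only [toSL_mul, toSL_inv, toSL_wOne, toSL_nElt, map_mul, map_inv])]
  simp only [SLZ.mul_apply, SLZ.W_10, SLZ.N_00, SLZ.W_11, SLZ.N_10]
  intro h
  exact not_isUnit_of_two_dvd (two_dvd_of_four_dvd h) (by simp)

/-- `w n(2) w` does not lie in `K₀ w K₀`. -/
lemma wOne_conj_ne {k k' : Cover} (hk : k ∈ K0) (hk' : k' ∈ K0) :
    wOne * nElt 1 ^ 2 * wOne ≠ k * wOne * k' := by
  intro h
  obtain ⟨m, hm4, hm⟩ := mem_K0_iff.1 hk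
  obtain ⟨m', hm4', hm'⟩ := mem_K0_iff.1 hk'
  have e : SLZ.W * SLZ.N (2 : ℕ) * SLZ.W = m * SLZ.W * m' := by
    apply SLZ.incl_injective
    simp only [map_mul, hm, hm', ← toSL_wOne, ← toSL_nElt]
    rw [nElt_natCast]
    exact congrArg toSL h
  have h1 := SLZ.det m
  have h2 := SLZ.det m'
  have e' : (SLZ.W * SLZ.N (2 : ℕ) * SLZ.W) 1 0 = (m * SLZ.W * m') 1 0 := by rw [e]
  simp [SLZ.mul_apply] at e'
  refine not_isUnit_of_two_dvd (x := 1) ?_ isUnit_one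
  have h10 := two_dvd_of_four_dvd hm4
  have h10' := two_dvd_of_four_dvd hm4'
  -- The lower left entries give 2 = cc' - da'. Multiplying by ad' and using both determinants
  -- exhibits 1 as an even number.
  have : (1 : ℤ_[2]) = m 1 0 * (m 0 0 * m' 1 1 * m' 1 0 - m 0 1 * (m' 0 0 * m' 1 1)) -
      m' 0 1 * m' 1 0 - 2 * (m 0 0 * m' 1 1) := by
    linear_combination (m 0 0 * m' 1 1) * e' - (m' 0 0 * m' 1 1) * h1 - h2
  rw [this]
  exact dvd_sub (dvd_sub (Dvd.dvd.mul_right h10 _) (Dvd.dvd.mul_left h10' _)) (dvd_mul_right _ _)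

/-- Here j is b/d modulo 4. Together with `nElt_mul_wOne_inj` this decomposes K₀wK₀ into the four
left cosets nʲ w K₀. -/
lemma exists_eq_nElt_mul {k : Cover} (hk : k ∈ K0) :
    ∃ j : Fin 4, ∃ k' ∈ K0, k * wOne = nElt 1 ^ (j : ℕ) * wOne * k' := by
  obtain ⟨m, h4, hm⟩ := mem_K0_iff.1 hk
  have hd : IsUnit (m 1 1) := by
    refine (isUnit_or_two_dvd _).resolve_right fun h' => not_isUnit_of_two_dvd ?_ isUnit_one
    rw [← SLZ.det m]
    exact dvd_sub (Dvd.dvd.mul_left h' _) (Dvd.dvd.mul_left (two_dvd_of_four_dvd h4) _)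
  obtain ⟨s, hs⟩ := hd.exists_right_inv
  obtain ⟨j, hj⟩ := exists_four_dvd_sub (m 0 1 * s)
  refine ⟨j, (nElt 1 ^ (j : ℕ) * wOne)⁻¹ * (k * wOne), ?_, (mul_inv_cancel_left _ _).symm⟩
  rw [← nElt_natCast, mem_K0_of_incl (m := (SLZ.N (j : ℕ) * SLZ.W)⁻¹ * (m * SLZ.W)) (by
      simp only [toSL_mul, toSL_inv, toSL_wOne, toSL_nElt, map_mul, map_inv, hm])]
  have : ((SLZ.N (j : ℕ) * SLZ.W)⁻¹ * (m * SLZ.W)) 1 0 = -m 1 1 * (m 0 1 * s - j) := by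
    rw [mul_inv_rev]
    simp [SLZ.mul_apply, Matrix.SpecialLinearGroup.coe_inv, Matrix.adjugate_fin_two]
    linear_combination (m 0 1) * hs
  rw [this]
  exact Dvd.dvd.mul_left hj _

lemma nElt_mul_wOne_inj {i j : Fin 4}
    (h : (nElt 1 ^ (i : ℕ) * wOne)⁻¹ * (nElt 1 ^ (j : ℕ) * wOne) ∈ K0) : i = j := by
  rw [← nElt_natCast, ← nElt_natCast,
    mem_K0_of_incl (m := (SLZ.N (i : ℕ) * SLZ.W)⁻¹ * (SLZ.N (j : ℕ) * SLZ.W)) (by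
      simp only [toSL_mul, toSL_inv, toSL_wOne, toSL_nElt, map_mul, map_inv])] at h
  apply eq_of_four_dvd_sub
  have : ((SLZ.N (i : ℕ) * SLZ.W)⁻¹ * (SLZ.N (j : ℕ) * SLZ.W)) 1 0
      = ((i : ℕ) : ℤ_[2]) - (j : ℕ) := by
    rw [mul_inv_rev]
    simp [SLZ.mul_apply, Matrix.SpecialLinearGroup.coe_inv, Matrix.adjugate_fin_two]
    ring
  rwa [this] at h

end Cover

/-! ### Sums over coset spaces -/

section CosetSum

variable {G : Type*} [Group G] (H : Subgroup G)

lemma apply_out_mk {M : Type*} {F : G → M} (hF : ∀ g, ∀ h ∈ H, F (g * h) = F g) (g : G) :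
    F (QuotientGroup.mk (s := H) g).out = F g := by
  obtain ⟨h, hh⟩ := QuotientGroup.mk_out_eq_mul H g
  rw [hh, hF _ _ h.2]

variable {M : Type*} [AddCommMonoid M]

/-- Evaluates a coset integral at explicit representatives `r`: `hr` keeps their cosets distinct,
`h0` makes them cover the support, and `hF` frees the sum from the choice made by `out`. -/
lemma finsum_quotient_eq_sum {F : G → M} (hF : ∀ g, ∀ h ∈ H, F (g * h) = F g)
    {ι : Type*} [Fintype ι] (r : ι → G) (hr : ∀ i j, (r i)⁻¹ * r j ∈ H → i = j)
    (h0 : ∀ g, F g ≠ 0 → ∃ i, ∃ h ∈ H, g = r i * h) :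
    ∑ᶠ q : G ⧸ H, F q.out = ∑ i, F (r i) := by
  classical
  have hinj : Function.Injective fun i => (QuotientGroup.mk (r i) : G ⧸ H) :=
    fun i j hij => hr i j (QuotientGroup.eq.1 hij)
  rw [finsum_eq_sum_of_support_subset (s := Finset.univ.image fun i => (r i : G ⧸ H)),
    Finset.sum_image fun i _ j _ h => hinj h]
  · exact Finset.sum_congr rfl fun i _ => apply_out_mk H hF _
  · intro q hq
    obtain ⟨i, h, hh, e⟩ := h0 _ hq
    rw [Finset.coe_image]
    refine ⟨i, by simp, ?_⟩
    rw [← q.out_eq', e]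
    exact (QuotientGroup.eq.2 (by simpa using hh))

/-- Left invariance of the Haar measure, in terms of cosets. -/
lemma finsum_quotient_translate {F : G → M} (hF : ∀ g, ∀ h ∈ H, F (g * h) = F g) (k : G) :
    ∑ᶠ q : G ⧸ H, F q.out = ∑ᶠ q : G ⧸ H, F (k * q.out) := by
  rw [← finsum_comp_equiv (MulAction.toPerm k)]
  refine finsum_congr fun q => ?_
  have : (MulAction.toPerm k q : G ⧸ H) = QuotientGroup.mk (k * q.out) := by
    conv_lhs => rw [← q.out_eq']
    rfl
  rw [this, apply_out_mk H hF]

end CosetSum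

/-! ### The extended character -/

variable (γ : Subgroup.center Cover →* ℂˣ)

lemma extChar_center_mul (m : Subgroup.center Cover) {k : Cover} (hk : k ∈ K1) :
    extChar γ (m * k) = γ m := by
  have h : ∃ m' : Subgroup.center Cover, ∃ k' ∈ K1, (m : Cover) * k = m' * k' := ⟨m, k, hk, rfl⟩
  rw [extChar, dif_pos h]
  obtain ⟨k', hk', e⟩ := h.choose_spec
  rw [← center_mul_unique hk hk' e]

lemma extChar_center (m : Subgroup.center Cover) : extChar γ m = γ m := by
  simpa using extChar_center_mul γ m one_mem_K1

lemma extChar_K1 {k : Cover} (hk : k ∈ K1) : extChar γ k = 1 := by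
  simpa using extChar_center_mul γ 1 hk

lemma extChar_one : extChar γ 1 = 1 := extChar_K1 γ one_mem_K1

lemma extChar_mul {p q : Cover} (hp : p ∈ K0) (hq : q ∈ K0) :
    extChar γ (p * q) = extChar γ p * extChar γ q := by
  obtain ⟨m, k, hk, rfl⟩ := exists_center_mul hp
  obtain ⟨m', k', hk', rfl⟩ := exists_center_mul hq
  have e : (m : Cover) * k * (m' * k') = ((m * m' : Subgroup.center Cover) : Cover) * (k * k') := by
    have := (Subgroup.mem_center_iff.1 m'.2 k)
    rw [Subgroup.coe_mul, mul_assoc, mul_assoc, ← mul_assoc k, this, mul_assoc]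
  rw [e, extChar_center_mul γ _ (mul_mem_K1 hk hk'), extChar_center_mul γ _ hk,
    extChar_center_mul γ _ hk', map_mul, Units.val_mul]

lemma extChar_eq_zero {p : Cover} (hp : p ∉ K0) : extChar γ p = 0 := by
  rw [extChar, dif_neg]
  rintro ⟨m, k, hk, rfl⟩
  exact hp (mul_mem (center_le_K0 m.2) (K1_subset_K0 hk))

lemma extChar_inv_mul {p : Cover} (hp : p ∈ K0) : extChar γ p⁻¹ * extChar γ p = 1 := by
  rw [← extChar_mul γ (inv_mem hp) hp, inv_mul_cancel, extChar_one]

/-- Makes the values of γ roots of unity, so that complex conjugation inverts them. -/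
lemma center_pow_four (m : Subgroup.center Cover) : m ^ 4 = 1 := by
  have h2 : ((m : Cover) ^ 2).toSL = 1 := by
    rw [pow_two, toSL_mul]
    rcases mem_center_iff.1 m.2 with h | h <;> simp [h]
  apply Subtype.ext
  rw [Subgroup.coe_pow, pow_mul (m : Cover) 2 2]
  generalize (m : Cover) ^ 2 = p at h2
  obtain ⟨g, ε⟩ := p
  obtain rfl : g = 1 := h2
  simp [pow_two, mul_def, cocycle.one_left, Int.units_mul_self, one_def]

lemma star_extChar {p : Cover} (hp : p ∈ K0) : star (extChar γ p) = extChar γ p⁻¹ := by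
  have h1 := extChar_inv_mul γ hp
  have h2 : star (extChar γ p) * extChar γ p = 1 := by
    obtain ⟨m, k, hk, rfl⟩ := exists_center_mul hp
    rw [extChar_center_mul γ m hk]
    have h4 : ((γ m : ℂˣ) : ℂ) ^ 4 = 1 := by
      rw [← Units.val_pow_eq_pow_val, ← map_pow, center_pow_four, map_one, Units.val_one]
    have hn : ‖((γ m : ℂˣ) : ℂ)‖ = 1 := Complex.norm_eq_one_of_pow_eq_one h4 (by norm_num)
    rw [Complex.star_def, Complex.conj_mul', hn]; simp
  have h3 : extChar γ p ≠ 0 := by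
    intro h; rw [h, mul_zero] at h1; exact zero_ne_one h1
  exact mul_right_cancel₀ h3 (h2.trans h1.symm)

lemma star_extChar_inv {p : Cover} (hp : p ∈ K0) : star (extChar γ p⁻¹) = extChar γ p := by
  rw [star_extChar γ (inv_mem hp), inv_inv]

/-- The central part of `p` commutes with w and can be divided out; what is left lies in K₁, and so
does its conjugate by w. -/
lemma extChar_eq_of_mul_wOne {p q : Cover} (hp : p ∈ K0) (hq : q ∈ K0)
    (h : p * wOne = wOne * q) : extChar γ p = extChar γ q := by
  obtain ⟨m, k, hk, rfl⟩ := exists_center_mul hp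
  have h1 : k * wOne = wOne * ((m : Cover)⁻¹ * q) := by
    have hm' : wOne * (m : Cover)⁻¹ = (m : Cover)⁻¹ * wOne :=
      Subgroup.mem_center_iff.1 (inv_mem m.2) wOne
    rw [← mul_assoc, hm', mul_assoc, ← h]
    group
  have hq' := mem_K1_of_mul_wOne hk (mul_mem (inv_mem (center_le_K0 m.2)) hq) h1
  have e : q = m * ((m : Cover)⁻¹ * q) := by simp
  rw [e, extChar_center_mul γ m hk, extChar_center_mul γ m hq']

/-! ### Values of Hecke functions -/

section HeckeFn

variable {g : Cover}

/-- The definition picks some decomposition of the argument. The hypothesis `hg` is the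
compatibility of γ on K₀ ∩ gK₀g⁻¹ that makes the value independent of this choice. -/
lemma heckeFn_apply
    (hg : ∀ p ∈ K0, ∀ q ∈ K0, p * g = g * q → extChar γ p = extChar γ q) (c : ℂ)
    {k k' : Cover} (hk : k ∈ K0) (hk' : k' ∈ K0) :
    heckeFn γ g c (k * g * k') = star (extChar γ k) * star c * star (extChar γ k') := by
  have h : ∃ p : K0 × K0, k * g * k' = p.1 * g * p.2 := ⟨(⟨k, hk⟩, ⟨k', hk'⟩), rfl⟩
  rw [heckeFn, dif_pos h]
  have e := h.choose_spec
  set l := (h.choose.1 : Cover) with hl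
  set l' := (h.choose.2 : Cover) with hl'
  have ml : l ∈ K0 := h.choose.1.2
  have ml' : l' ∈ K0 := h.choose.2.2
  -- From k g k' = l g l' follows (l⁻¹k) g = g (l'k'⁻¹).
  have key := hg (l⁻¹ * k) (mul_mem (inv_mem ml) hk) (l' * k'⁻¹) (mul_mem ml' (inv_mem hk')) (by
    rw [mul_assoc, inv_mul_eq_iff_eq_mul, ← mul_assoc, ← mul_assoc, eq_mul_inv_iff_mul_eq, e])
  rw [extChar_mul γ (inv_mem ml) hk, extChar_mul γ ml' (inv_mem hk')] at key
  have h1 := extChar_inv_mul γ ml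
  have h2 := extChar_inv_mul γ hk'
  have key' : extChar γ k * extChar γ k' = extChar γ l * extChar γ l' := by
    linear_combination (extChar γ l * extChar γ k') * key - (extChar γ k * extChar γ k') * h1 +
      (extChar γ l * extChar γ l') * h2
  have key'' := congrArg star key'
  rw [star_mul', star_mul'] at key''
  linear_combination (-star c) * key''

lemma heckeFn_eq_zero (c : ℂ) {x : Cover} (h : ∀ k ∈ K0, ∀ k' ∈ K0, x ≠ k * g * k') :
    heckeFn γ g c x = 0 := by
  rw [heckeFn, dif_neg]
  rintro ⟨⟨k, k'⟩, e⟩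
  exact h k k.2 k' k'.2 e

lemma heckeFn_mul
    (hg : ∀ p ∈ K0, ∀ q ∈ K0, p * g = g * q → extChar γ p = extChar γ q) (c : ℂ)
    {k k' : Cover} (hk : k ∈ K0) (hk' : k' ∈ K0) (x : Cover) :
    heckeFn γ g c (k * x * k') = star (extChar γ k) * heckeFn γ g c x * star (extChar γ k') := by
  by_cases h : ∃ l ∈ K0, ∃ l' ∈ K0, x = l * g * l'
  · obtain ⟨l, hl, l', hl', rfl⟩ := h
    have e : k * (l * g * l') * k' = (k * l) * g * (l' * k') := by group
    rw [e, heckeFn_apply γ hg c (mul_mem hk hl) (mul_mem hl' hk'), heckeFn_apply γ hg c hl hl',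
      extChar_mul γ hk hl, extChar_mul γ hl' hk', star_mul', star_mul']
    ring
  · rw [heckeFn_eq_zero γ c fun l hl l' hl' e => h ⟨l, hl, l', hl', e⟩, heckeFn_eq_zero γ c]
    · simp
    · intro l hl l' hl' e
      refine h ⟨k⁻¹ * l, mul_mem (inv_mem hk) hl, l' * k'⁻¹, mul_mem hl' (inv_mem hk'), ?_⟩
      have : x = k⁻¹ * (k * x * k') * k'⁻¹ := by group
      rw [this, e]; group

end HeckeFn

lemma extChar_eq_of_mul_one :
    ∀ p ∈ K0, ∀ q ∈ K0, p * 1 = 1 * q → extChar γ p = extChar γ q := by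
  intro p _ q _ h
  rw [mul_one, one_mul] at h
  rw [h]

lemma extChar_wOne_conj :
    ∀ p ∈ K0, ∀ q ∈ K0, p * wOne = wOne * q → extChar γ p = extChar γ q :=
  fun _ hp _ hq h => extChar_eq_of_mul_wOne γ hp hq h

lemma Tw_mul {k k' : Cover} (hk : k ∈ K0) (hk' : k' ∈ K0) (x : Cover) :
    Tw γ (k * x * k') = star (extChar γ k) * Tw γ x * star (extChar γ k') := by
  unfold Tw
  rw [heckeFn_mul γ (extChar_wOne_conj γ) _ hk hk']
  ring

lemma F2_mul {k k' : Cover} (hk : k ∈ K0) (hk' : k' ∈ K0) (x : Cover) :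
    F2 γ (k * x * k') = star (extChar γ k) * F2 γ x * star (extChar γ k') := by
  unfold F2
  rw [Tw_mul γ hk hk', heckeFn_mul γ (extChar_eq_of_mul_one γ) _ hk hk']
  ring

lemma F2hat_mul {k k' : Cover} (hk : k ∈ K0) (hk' : k' ∈ K0) (x : Cover) :
    F2hat γ (k * x * k') = extChar γ k * F2hat γ x * extChar γ k' := by
  unfold F2hat
  have e : (k * x * k')⁻¹ = k'⁻¹ * x⁻¹ * k⁻¹ := by group
  rw [e, F2_mul γ (inv_mem hk') (inv_mem hk), star_extChar_inv γ hk, star_extChar_inv γ hk']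
  ring

lemma F2hat_mul_left {k : Cover} (hk : k ∈ K0) (x : Cover) :
    F2hat γ (k * x) = extChar γ k * F2hat γ x := by
  simpa [extChar_one] using F2hat_mul γ hk (one_mem K0) x

lemma F2hat_mul_right {k : Cover} (hk : k ∈ K0) (x : Cover) :
    F2hat γ (x * k) = F2hat γ x * extChar γ k := by
  simpa [extChar_one] using F2hat_mul γ (one_mem K0) hk x

/-- The value `γ(h(-1))`, a square root of `-1`. -/
def gammaH : ℂ := (γ ⟨hNegOne, hNegOne_mem_center⟩ : ℂ)

lemma hNegOne_mem_K0 : hNegOne ∈ K0 := center_le_K0 hNegOne_mem_center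

lemma extChar_hNegOne : extChar γ hNegOne = gammaH γ :=
  extChar_center γ ⟨hNegOne, hNegOne_mem_center⟩

/-! ### Explicit values of T_w, F₂ and F̂₂ -/

variable {γ}

lemma gammaH_sq (hγ : IsGenuine γ) : gammaH γ ^ 2 = -1 := by
  have : (⟨hNegOne, hNegOne_mem_center⟩ : Subgroup.center Cover) *
      ⟨hNegOne, hNegOne_mem_center⟩ = ⟨negSign, negSign_mem_center⟩ :=
    Subtype.ext hNegOne_mul_hNegOne
  unfold gammaH
  rw [pow_two, ← Units.val_mul, ← map_mul, this]
  unfold IsGenuine at hγ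
  rw [hγ]; simp

lemma star_gammaH (hγ : IsGenuine γ) : star (gammaH γ) = -gammaH γ := by
  have h1 := extChar_inv_mul γ hNegOne_mem_K0
  rw [← star_extChar γ hNegOne_mem_K0, extChar_hNegOne] at h1
  linear_combination (-gammaH γ) * h1 + star (gammaH γ) * gammaH_sq hγ

lemma sqrt_two_mul : (Real.sqrt 2 : ℂ) * (Real.sqrt 2 : ℂ) = 2 := by
  rw [← Complex.ofReal_mul, Real.mul_self_sqrt (by norm_num)]; simp

lemma star_zeta_div (hγ : IsGenuine γ) :
    star (zeta γ) / (Real.sqrt 2 : ℂ) = (1 - gammaH γ) / 2 := by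
  have h2 : (Real.sqrt 2 : ℂ) ≠ 0 := by
    intro h; have := sqrt_two_mul; rw [h] at this; simp at this
  have : star (zeta γ) = (1 - gammaH γ) / (Real.sqrt 2 : ℂ) := by
    change star ((1 + gammaH γ) / (Real.sqrt 2 : ℂ)) = _
    rw [star_div₀, star_add, star_one, star_gammaH hγ, Complex.star_def, Complex.conj_ofReal]
    ring
  rw [this, div_div, sqrt_two_mul]

lemma not_mem_K0_of_eq {x k k' : Cover} (hk : k ∈ K0) (hk' : k' ∈ K0) (h : x = k * wOne * k') :
    x ∉ K0 := by
  intro hx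
  apply not_mem_K0_wOne_mul 0
  rw [nElt_zero, mul_one]
  have : wOne = k⁻¹ * x * k'⁻¹ := by rw [h]; group
  rw [this]
  exact mul_mem (mul_mem (inv_mem hk) hx) (inv_mem hk')

lemma Tw_apply (hγ : IsGenuine γ) {k k' : Cover} (hk : k ∈ K0) (hk' : k' ∈ K0) :
    Tw γ (k * wOne * k') =
      star (extChar γ k) * ((1 - gammaH γ) / 2) * star (extChar γ k') := by
  unfold Tw
  rw [heckeFn_apply γ (extChar_wOne_conj γ) _ hk hk', ← star_zeta_div hγ]
  ring

lemma Tw_eq_zero {x : Cover} (h : ∀ k ∈ K0, ∀ k' ∈ K0, x ≠ k * wOne * k') : Tw γ x = 0 := by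
  rw [Tw, heckeFn_eq_zero γ _ h, zero_div]

lemma F2_of_wOne (hγ : IsGenuine γ) {k k' : Cover} (hk : k ∈ K0) (hk' : k' ∈ K0) :
    F2 γ (k * wOne * k') =
      star (extChar γ k) * ((1 - gammaH γ) / 6) * star (extChar γ k') := by
  unfold F2
  rw [Tw_apply hγ hk hk', heckeFn_eq_zero]
  · ring
  · intro l hl l' hl' e
    refine not_mem_K0_of_eq hk hk' rfl ?_
    rw [e, mul_one]
    exact mul_mem hl hl'

lemma F2_of_mem {k : Cover} (hk : k ∈ K0) : F2 γ k = star (extChar γ k) / 3 := by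
  unfold F2
  have h1 := heckeFn_apply γ (extChar_eq_of_mul_one γ) 1 hk (one_mem K0)
  rw [mul_one, mul_one] at h1
  rw [Tw_eq_zero fun l hl l' hl' e => not_mem_K0_of_eq hl hl' e hk, h1, extChar_one]
  simp

lemma F2_eq_zero {x : Cover} (h0 : x ∉ K0) (h : ∀ k ∈ K0, ∀ k' ∈ K0, x ≠ k * wOne * k') :
    F2 γ x = 0 := by
  unfold F2
  rw [Tw_eq_zero h, heckeFn_eq_zero]
  · simp
  · rintro l hl l' hl' rfl
    rw [mul_one] at h0
    exact h0 (mul_mem hl hl')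

lemma wOne_inv : wOne⁻¹ = wOne * hNegOne⁻¹ := by
  rw [← wOne_mul_wOne]; group

lemma F2hat_of_mem {k : Cover} (hk : k ∈ K0) : F2hat γ k = extChar γ k / 3 := by
  rw [F2hat, F2_of_mem (inv_mem hk), star_extChar_inv γ hk]

/-- Since w⁻¹ = w h(-1)⁻¹, the value is i(1 - i)/6. -/
lemma F2hat_wOne (hγ : IsGenuine γ) : F2hat γ wOne = (1 + gammaH γ) / 6 := by
  have := F2_of_wOne hγ (one_mem K0) (inv_mem hNegOne_mem_K0)
  rw [one_mul, star_extChar_inv γ hNegOne_mem_K0, extChar_one, extChar_hNegOne] at this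
  rw [F2hat, wOne_inv, this, star_one]
  linear_combination (-1 / 6) * gammaH_sq hγ

lemma F2hat_wOne_conj : F2hat γ (wOne * nElt 1 ^ 2 * wOne) = 0 := by
  apply F2_eq_zero
  · intro h
    exact not_mem_K0_wOne_conj (inv_mem_iff.1 h)
  · intro k hk k' hk' e
    apply wOne_conj_ne (inv_mem hk') (mul_mem (inv_mem hNegOne_mem_K0) (inv_mem hk))
    rw [← inv_inv (wOne * nElt 1 ^ 2 * wOne), e, mul_inv_rev, mul_inv_rev, wOne_inv]
    group

lemma nElt_mem_K0 (x : ℤ_[2]) : nElt x ∈ K0 := K1_subset_K0 (nElt_mem_K1 x)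

lemma extChar_nElt (x : ℤ_[2]) : extChar γ (nElt x) = 1 := extChar_K1 γ (nElt_mem_K1 x)

lemma nElt_pow_mem_K1 (j : ℕ) : nElt 1 ^ j ∈ K1 := nElt_natCast j ▸ nElt_mem_K1 _

lemma nElt_inv_mem_K1 : (nElt 1)⁻¹ ∈ K1 := nElt_neg 1 ▸ nElt_mem_K1 _

lemma hNegOne_comm (p : Cover) : p * hNegOne = hNegOne * p :=
  Subgroup.mem_center_iff.1 hNegOne_mem_center p

/-- The inverse of the braid relation, multiplied on both sides by the central element w² = h(-1).
-/
lemma wOne_nElt_wOne : wOne * nElt 1 * wOne = hNegOne * ((nElt 1)⁻¹ * wOne * (nElt 1)⁻¹) := by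
  have h := congrArg (fun p => wOne * wOne * p⁻¹ * (wOne * wOne)) braid
  have e1 : wOne * wOne * (wOne * nElt (-1) * wOne)⁻¹ * (wOne * wOne) =
      wOne * nElt 1 * wOne := by
    rw [nElt_neg]; group
  have e2 : wOne * wOne * (nElt 1 * wOne * nElt 1)⁻¹ * (wOne * wOne) =
      wOne * wOne * ((nElt 1)⁻¹ * wOne * (nElt 1)⁻¹) := by
    have h1 := hNegOne_comm ((nElt 1)⁻¹)
    rw [← wOne_mul_wOne] at h1
    have : wOne * wOne * (nElt 1 * wOne * nElt 1)⁻¹ * (wOne * wOne) =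
      wOne * wOne * ((nElt 1)⁻¹ * wOne⁻¹ * ((nElt 1)⁻¹ * (wOne * wOne))) := by group
    rw [this, h1]; group
  rw [e1, e2] at h
  rw [← h, wOne_mul_wOne]

lemma F2hat_wOne_pow_zero : F2hat γ (wOne * nElt 1 ^ 0 * wOne) = gammaH γ / 3 := by
  rw [pow_zero, mul_one, wOne_mul_wOne, F2hat_of_mem hNegOne_mem_K0, extChar_hNegOne]

lemma F2hat_wOne_pow_one (hγ : IsGenuine γ) :
    F2hat γ (wOne * nElt 1 ^ 1 * wOne) = (gammaH γ - 1) / 6 := by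
  have hn := K1_subset_K0 nElt_inv_mem_K1
  rw [pow_one, wOne_nElt_wOne, F2hat_mul_left γ hNegOne_mem_K0, F2hat_mul γ hn hn,
    extChar_K1 γ nElt_inv_mem_K1, F2hat_wOne hγ, extChar_hNegOne]
  linear_combination (1 / 6) * gammaH_sq hγ

lemma extChar_wOne_conj_pow_four : extChar γ (wOne * nElt 1 ^ 4 * wOne⁻¹) = 1 := by
  rw [extChar_eq_of_mul_wOne γ wOne_conj_mem_K0 (K1_subset_K0 (nElt_pow_mem_K1 4)) (by group),
    extChar_K1 γ (nElt_pow_mem_K1 4)]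

/-- Split n³ = n⁴ n⁻¹: γ is 1 on w n⁴ w⁻¹, and w n⁻¹ w is n w n by the braid relation. -/
lemma F2hat_wOne_pow_three (hγ : IsGenuine γ) :
    F2hat γ (wOne * nElt 1 ^ 3 * wOne) = (1 + gammaH γ) / 6 := by
  have e : wOne * nElt 1 ^ 3 * wOne =
      (wOne * nElt 1 ^ 4 * wOne⁻¹) * (wOne * (nElt 1)⁻¹ * wOne) := by group
  rw [e, F2hat_mul_left γ wOne_conj_mem_K0, extChar_wOne_conj_pow_four, ← nElt_neg, ← braid,
    F2hat_mul γ (nElt_mem_K0 1) (nElt_mem_K0 1), extChar_nElt, F2hat_wOne hγ]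
  ring

lemma F2hat_wOne_pow_four : F2hat γ (wOne * nElt 1 ^ 4 * wOne) = gammaH γ / 3 := by
  have e : wOne * nElt 1 ^ 4 * wOne = (wOne * nElt 1 ^ 4 * wOne⁻¹) * (wOne * wOne) := by group
  rw [e, F2hat_mul_left γ wOne_conj_mem_K0, extChar_wOne_conj_pow_four, wOne_mul_wOne,
    F2hat_of_mem hNegOne_mem_K0, extChar_hNegOne, one_mul]

/-- The three-term relation between the translates of `F̂₂` by `1`, `w` and `n(1) w`. -/
lemma F2hat_nElt_wOne (hγ : IsGenuine γ) {x : Cover} (hx : x ∈ K) :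
    F2hat γ (x * (nElt 1 * wOne)) = F2hat γ x + gammaH γ * F2hat γ (x * wOne) := by
  have hi := gammaH_sq hγ
  -- All three terms scale by γ(k) under left translation by K₀, so the six coset representatives
  -- suffice.
  have reduce {y k : Cover} (hk : k ∈ K0) (h : F2hat γ (y * (nElt 1 * wOne)) =
      F2hat γ y + gammaH γ * F2hat γ (y * wOne)) :
      F2hat γ (k * y * (nElt 1 * wOne)) =
        F2hat γ (k * y) + gammaH γ * F2hat γ (k * y * wOne) := by
    rw [mul_assoc, mul_assoc k y wOne, F2hat_mul_left γ hk, F2hat_mul_left γ hk,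
      F2hat_mul_left γ hk, h]
    ring
  rcases exists_mem_K0_mul hx with hx | ⟨j, k, hk, rfl⟩ | ⟨k, hk, rfl⟩
  · have := reduce (y := 1) hx (by
      rw [one_mul, one_mul, F2hat_mul_left γ (nElt_mem_K0 1), extChar_nElt, F2hat_wOne hγ,
        F2hat_of_mem (one_mem K0), extChar_one]
      linear_combination (-1 / 6) * hi)
    rwa [mul_one] at this
  · apply reduce hk
    have e (j : ℕ) : F2hat γ (wOne * nElt 1 ^ j) = (1 + gammaH γ) / 6 := by
      rw [F2hat_mul_right γ (K1_subset_K0 (nElt_pow_mem_K1 j)), extChar_K1 γ (nElt_pow_mem_K1 j),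
        F2hat_wOne hγ, mul_one]
    have e' : wOne * nElt 1 ^ (j : ℕ) * (nElt 1 * wOne) = wOne * nElt 1 ^ ((j : ℕ) + 1) * wOne := by
      rw [pow_succ]; simp only [mul_assoc]
    rw [e, e']
    -- The value at w nʲ⁺¹ w is compared with that at w nʲ w, which is why j = 3 needs the value at
    -- w n⁴ w.
    fin_cases j
    · refine (F2hat_wOne_pow_one hγ).trans ?_
      refine Eq.trans ?_ (congrArg (fun t => _ + gammaH γ * t) F2hat_wOne_pow_zero.symm)
      linear_combination (-1 / 3) * hi
    · refine F2hat_wOne_conj.trans ?_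
      refine Eq.trans ?_ (congrArg (fun t => _ + gammaH γ * t) (F2hat_wOne_pow_one hγ).symm)
      linear_combination (-1 / 6) * hi
    · refine (F2hat_wOne_pow_three hγ).trans ?_
      refine Eq.trans ?_ (congrArg (fun t => _ + gammaH γ * t) F2hat_wOne_conj.symm)
      ring
    · refine F2hat_wOne_pow_four.trans ?_
      refine Eq.trans ?_ (congrArg (fun t => _ + gammaH γ * t) (F2hat_wOne_pow_three hγ).symm)
      linear_combination (-1 / 6) * hi
  · apply reduce hk
    -- Two applications of `wOne_nElt_wOne`, each of which releases a factor h(-1).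
    have e1 : wOne * nElt 1 ^ 2 * wOne * (nElt 1 * wOne) =
        hNegOne * hNegOne * ((nElt 1)⁻¹ * wOne * (nElt 1)⁻¹ * (nElt 1)⁻¹) := by
      have : wOne * nElt 1 ^ 2 * wOne * (nElt 1 * wOne) =
          wOne * nElt 1 ^ 2 * (wOne * nElt 1 * wOne) := by group
      rw [this, wOne_nElt_wOne, ← mul_assoc, hNegOne_comm]
      have : hNegOne * (wOne * nElt 1 ^ 2) * ((nElt 1)⁻¹ * wOne * (nElt 1)⁻¹) =
        hNegOne * (wOne * nElt 1 * wOne) * (nElt 1)⁻¹ := by group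
      rw [this, wOne_nElt_wOne]; group
    have e2 : wOne * nElt 1 ^ 2 * wOne * wOne = wOne * (nElt 1 ^ 2 * hNegOne) := by
      rw [← wOne_mul_wOne]; simp only [mul_assoc]
    have hn := K1_subset_K0 nElt_inv_mem_K1
    have h2 := K1_subset_K0 (nElt_pow_mem_K1 2)
    rw [e1, e2, F2hat_wOne_conj, F2hat_mul_left γ (mul_mem hNegOne_mem_K0 hNegOne_mem_K0),
      F2hat_mul_right γ hn, F2hat_mul γ hn hn, F2hat_mul_right γ (mul_mem h2 hNegOne_mem_K0),
      extChar_mul γ h2 hNegOne_mem_K0, extChar_mul γ hNegOne_mem_K0 hNegOne_mem_K0,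
      extChar_K1 γ nElt_inv_mem_K1, extChar_K1 γ (nElt_pow_mem_K1 2), F2hat_wOne hγ,
      extChar_hNegOne]
    ring

/-! ### The representation `V(2)` -/

/-- The element `w` of `K`. -/
def wK : K := ⟨wOne, wOne_mem_K⟩

/-- The element `n(1)` of `K`. -/
def nK : K := ⟨nElt 1, nElt_mem_K 1⟩

lemma piR_apply (k : K) (φ : K → ℂ) (x : K) : piR k φ x = φ (x * k) := rfl

lemma piR_mul (k k' : K) (φ : K → ℂ) : piR (k * k') φ = piR k (piR k' φ) := by
  rw [map_mul]; rfl

variable (γ) in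
/-- The span of `F̂₂` and its translate by `w`. -/
def spanF2hat : Submodule ℂ (K → ℂ) := Submodule.span ℂ {F2hatK γ, piR wK (F2hatK γ)}

lemma F2hatK_mem_span : F2hatK γ ∈ spanF2hat γ := Submodule.subset_span (by simp)

lemma piR_wK_mem_span : piR wK (F2hatK γ) ∈ spanF2hat γ := Submodule.subset_span (by simp)

lemma piR_of_mem_K0 {k : K} (hk : (k : Cover) ∈ K0) :
    piR k (F2hatK γ) = extChar γ k • F2hatK γ := by
  funext x
  exact (F2hat_mul_right γ hk x).trans (mul_comm _ _)

lemma piR_nK : piR nK (F2hatK γ) = F2hatK γ := by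
  rw [piR_of_mem_K0 (nElt_mem_K0 1)]
  change extChar γ (nElt 1) • _ = _
  rw [extChar_nElt, one_smul]

lemma piR_wK_wK : piR wK (piR wK (F2hatK γ)) = gammaH γ • F2hatK γ := by
  have h : ((wK * wK : K) : Cover) = hNegOne := wOne_mul_wOne
  rw [← piR_mul, piR_of_mem_K0 (by rw [h]; exact hNegOne_mem_K0), h, extChar_hNegOne]

lemma piR_nK_wK (hγ : IsGenuine γ) :
    piR nK (piR wK (F2hatK γ)) = F2hatK γ + gammaH γ • piR wK (F2hatK γ) := by
  funext x
  refine Eq.trans ?_ (F2hat_nElt_wOne hγ x.2)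
  rw [← mul_assoc]; rfl

lemma map_mem_of_mem_span_pair {E : Type*} [AddCommGroup E] [Module ℂ E] (T : E →ₗ[ℂ] E)
    {N : Submodule ℂ E} {a b φ : E} (h1 : T a ∈ N) (h2 : T b ∈ N)
    (hφ : φ ∈ Submodule.span ℂ {a, b}) : T φ ∈ N := by
  obtain ⟨s, t, rfl⟩ := Submodule.mem_span_pair.1 hφ
  rw [map_add, map_smul, map_smul]
  exact add_mem (N.smul_mem _ h1) (N.smul_mem _ h2)

lemma wK_inv_mem_span (hγ : IsGenuine γ) {φ : K → ℂ} (hφ : φ ∈ spanF2hat γ) :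
    piR wK⁻¹ φ ∈ spanF2hat γ := by
  refine map_mem_of_mem_span_pair (piR _) ?_ ?_ hφ
  · have : F2hatK γ = piR wK ((-gammaH γ) • piR wK (F2hatK γ)) := by
      rw [map_smul, piR_wK_wK, smul_smul]
      have : -gammaH γ * gammaH γ = 1 := by linear_combination -gammaH_sq hγ
      rw [this, one_smul]
    rw [this, ← piR_mul, inv_mul_cancel, map_one]
    exact Submodule.smul_mem _ _ piR_wK_mem_span
  · rw [← piR_mul, inv_mul_cancel, map_one]
    exact F2hatK_mem_span

/-- Solving the three-term relation for w F̂₂ gives n(-i(w F̂₂ - F̂₂)) = w F̂₂. -/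
lemma nK_inv_mem_span (hγ : IsGenuine γ) {φ : K → ℂ} (hφ : φ ∈ spanF2hat γ) :
    piR nK⁻¹ φ ∈ spanF2hat γ := by
  refine map_mem_of_mem_span_pair (piR _) ?_ ?_ hφ
  · conv => enter [2]; rw [← piR_nK, ← piR_mul, inv_mul_cancel, map_one]
    exact F2hatK_mem_span
  · have : piR wK (F2hatK γ) =
        piR nK ((-gammaH γ) • (piR wK (F2hatK γ) - F2hatK γ)) := by
      rw [map_smul, map_sub, piR_nK, piR_nK_wK hγ, add_sub_cancel_left, smul_smul]
      have : -gammaH γ * gammaH γ = 1 := by linear_combination -gammaH_sq hγ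
      rw [this, one_smul]
    rw [this, ← piR_mul, inv_mul_cancel, map_one]
    exact Submodule.smul_mem _ _ (sub_mem piR_wK_mem_span F2hatK_mem_span)

lemma nK_inv_pow_mem_span (hγ : IsGenuine γ) (j : ℕ) {φ : K → ℂ} (hφ : φ ∈ spanF2hat γ) :
    piR (nK⁻¹ ^ j) φ ∈ spanF2hat γ := by
  induction j with
  | zero => rwa [pow_zero, map_one]
  | succ j ih =>
    rw [pow_succ', piR_mul]
    exact nK_inv_mem_span hγ ih

/-- Decomposing k⁻¹ rather than k puts the K₀-factor of k on the right, where it meets F̂₂ first and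
acts by a scalar. Only inverses of w and n remain. -/
lemma piR_F2hatK_mem_span (hγ : IsGenuine γ) (k : K) : piR k (F2hatK γ) ∈ spanF2hat γ := by
  have hK0 {k₀ : K} (h : (k₀ : Cover) ∈ K0) : piR k₀⁻¹ (F2hatK γ) ∈ spanF2hat γ := by
    rw [piR_of_mem_K0 (K0.inv_mem h)]
    exact Submodule.smul_mem _ _ F2hatK_mem_span
  rcases exists_mem_K0_mul (inv_mem k.2) with h | ⟨j, k₀, h, e⟩ | ⟨k₀, h, e⟩
  · have := hK0 (k₀ := k⁻¹) h
    rwa [inv_inv] at this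
  · have : k = nK⁻¹ ^ (j : ℕ) * wK⁻¹ * (⟨k₀, K0_le_K h⟩ : K)⁻¹ := by
      apply inv_injective
      apply Subtype.ext
      refine e.trans ?_
      simp [wK, nK]
    rw [this, piR_mul, piR_mul]
    exact nK_inv_pow_mem_span hγ _ (wK_inv_mem_span hγ (hK0 h))
  · have : k = wK⁻¹ * nK⁻¹ ^ 2 * wK⁻¹ * (⟨k₀, K0_le_K h⟩ : K)⁻¹ := by
      apply inv_injective
      apply Subtype.ext
      refine e.trans ?_
      simp [wK, nK, mul_assoc]
    rw [this, piR_mul, piR_mul, piR_mul]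
    exact wK_inv_mem_span hγ (nK_inv_pow_mem_span hγ _ (wK_inv_mem_span hγ (hK0 h)))

lemma IK_inv_mul {φ : K → ℂ} (hφ : φ ∈ IK γ) {k : K} (hk : k ∈ K0inK) (x : K) :
    φ (k⁻¹ * x) = extChar γ (k : Cover)⁻¹ * φ x :=
  hφ k⁻¹ (K0.inv_mem hk) x

/-- Replacing k by gk in ∫ F̂₂(k) φ(k⁻¹g) dk gives ∫ F̂₂(gk) φ(k⁻¹) dk, a combination of right
translates of F̂₂. -/
lemma piL_F2hat_apply {φ : K → ℂ} (hφ : φ ∈ IK γ) :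
    piL (F2hat γ) φ = ∑ᶠ q : K ⧸ K0inK, φ (q.out⁻¹) • piR q.out (F2hatK γ) := by
  have := Fintype.ofFinite (K ⧸ K0inK)
  funext g
  change ∑ᶠ q : K ⧸ K0inK, F2hat γ q.out * φ (q.out⁻¹ * g) = _
  rw [finsum_quotient_translate K0inK (F := fun x : K => F2hat γ x * φ (x⁻¹ * g)) _ g,
    finsum_eq_sum_of_fintype, finsum_eq_sum_of_fintype, Finset.sum_apply]
  · refine Finset.sum_congr rfl fun q _ => ?_
    rw [mul_inv_rev, inv_mul_cancel_right, mul_comm]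
    rfl
  · intro x k hk
    have hk' : (k : Cover) ∈ K0 := hk
    rw [mul_inv_rev, mul_assoc, IK_inv_mul hφ hk, Subgroup.coe_mul, F2hat_mul_right γ hk']
    linear_combination (F2hat γ x * φ (x⁻¹ * g)) * extChar_inv_mul γ hk'

lemma extChar_mem_IK : (fun x : K => extChar γ x) ∈ IK γ := by
  intro k₀ h k
  change extChar γ (k₀ * k) = extChar γ k₀ * extChar γ k
  by_cases hk : (k : Cover) ∈ K0
  · exact extChar_mul γ h hk
  · rw [extChar_eq_zero γ hk, extChar_eq_zero γ fun h' => hk ((Subgroup.mul_mem_cancel_left K0 h).1 h'),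
      mul_zero]

/-- The preimage is γ extended by zero outside K₀, a right unit for the convolution: in the sum at g
only the coset gK₀ contributes. -/
lemma F2hatK_mem_V2 : F2hatK γ ∈ (V2 γ).toSubmodule := by
  refine ⟨_, extChar_mem_IK, ?_⟩
  funext g
  change ∑ᶠ q : K ⧸ K0inK, F2hat γ q.out * extChar γ (q.out⁻¹ * g : K) = _
  rw [finsum_quotient_eq_sum K0inK (F := fun x : K => F2hat γ x * extChar γ (x⁻¹ * g : K))
    (ι := Unit) _ (fun _ => g) (fun _ _ _ => rfl)]
  · simp [extChar_one, F2hatK]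
  · intro x hx
    refine ⟨(), g⁻¹ * x, ?_, by group⟩
    have : ((x⁻¹ * g : K) : Cover) ∈ K0 := by
      by_contra h
      exact hx (by rw [extChar_eq_zero γ h, mul_zero])
    have h2 := K0inK.inv_mem (x := x⁻¹ * g) this
    simpa using h2
  · intro x k hk
    have hk' : (k : Cover) ∈ K0 := hk
    have h := IK_inv_mul (extChar_mem_IK (γ := γ)) hk (x⁻¹ * g)
    rw [mul_inv_rev, mul_assoc, h, Subgroup.coe_mul, F2hat_mul_right γ hk']
    linear_combination (F2hat γ x * extChar γ (x⁻¹ * g : K)) * extChar_inv_mul γ hk'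

lemma V2_eq_span (hγ : IsGenuine γ) : (V2 γ).toSubmodule = spanF2hat γ := by
  apply le_antisymm
  · rintro _ ⟨φ, hφ, rfl⟩
    have := Fintype.ofFinite (K ⧸ K0inK)
    rw [piL_F2hat_apply hφ, finsum_eq_sum_of_fintype]
    exact Submodule.sum_mem _ fun q _ => Submodule.smul_mem _ _ (piR_F2hatK_mem_span hγ _)
  · refine Submodule.span_le.2 ?_
    rintro _ (rfl | rfl)
    · exact F2hatK_mem_V2
    · exact (V2 γ).apply_mem_toSubmodule wK F2hatK_mem_V2

/-- At w n² w the function F̂₂ vanishes and its w-translate does not, so `t = 0`; evaluation at 1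
then gives `s = 0`. -/
lemma linearIndependent_F2hatK (hγ : IsGenuine γ) :
    LinearIndependent ℂ ![F2hatK γ, piR wK (F2hatK γ)] := by
  rw [LinearIndependent.pair_iff]
  intro s t h
  have hi := gammaH_sq hγ
  have h1 := congrFun h 1
  have h2 := congrFun h (wK * nK ^ 2 * wK)
  have e0 : F2hatK γ 1 = 1 / 3 := by
    change F2hat γ 1 = _
    rw [F2hat_of_mem (one_mem K0), extChar_one]
  have e1 : F2hatK γ (wK * nK ^ 2 * wK) = 0 := F2hat_wOne_conj
  have e2 : piR wK (F2hatK γ) (wK * nK ^ 2 * wK) = (1 + gammaH γ) / 6 * gammaH γ := by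
    change F2hat γ (wOne * nElt 1 ^ 2 * wOne * wOne) = _
    have h2 := K1_subset_K0 (nElt_pow_mem_K1 2)
    rw [mul_assoc, wOne_mul_wOne, F2hat_mul_right γ hNegOne_mem_K0, F2hat_mul_right γ h2,
      extChar_K1 γ (nElt_pow_mem_K1 2), extChar_hNegOne, F2hat_wOne hγ, mul_one]
  simp only [Pi.add_apply, Pi.smul_apply, smul_eq_mul, Pi.zero_apply, e0, e1, e2] at h1 h2
  have ht : t = 0 := by
    linear_combination (-3 * (1 + gammaH γ)) * h2 + (t / 2) * (gammaH γ + 2) * hi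
  refine ⟨?_, ht⟩
  rw [ht] at h1
  linear_combination 3 * h1

lemma finrank_V2 (hγ : IsGenuine γ) : Module.finrank ℂ (V2 γ).toSubmodule = 2 := by
  rw [V2_eq_span hγ, spanF2hat]
  have := finrank_span_eq_card (linearIndependent_F2hatK hγ)
  rwa [Matrix.range_cons, Matrix.range_cons, Matrix.range_empty, Set.union_empty,
    Set.singleton_union, Fintype.card_fin] at this

/-- It suffices to reach F̂₂, whose w-translate is then also in `N`. Unless `u` is already a
multiple of F̂₂, the operator n - 1 kills its F̂₂-component. -/
lemma span_le_of_invariant (hγ : IsGenuine γ) {N : Submodule ℂ (K → ℂ)}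
    (hN : ∀ k : K, ∀ φ ∈ N, piR k φ ∈ N) {u : K → ℂ} (hu : u ∈ N) (hu' : u ∈ spanF2hat γ)
    (hu0 : u ≠ 0) : spanF2hat γ ≤ N := by
  obtain ⟨s, t, rfl⟩ := Submodule.mem_span_pair.1 hu'
  have hi := gammaH_sq hγ
  have h0 : F2hatK γ ∈ N := by
    by_cases ht : t = 0
    · subst ht
      rw [zero_smul, add_zero] at hu hu0
      have hs : s ≠ 0 := by rintro rfl; simp at hu0
      have := N.smul_mem s⁻¹ hu
      rwa [smul_smul, inv_mul_cancel₀ hs, one_smul] at this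
    -- This produces F̂₂ + (i - 1) w F̂₂, an eigenvector of n with eigenvalue i.
    · have h1 := N.smul_mem t⁻¹ (sub_mem (hN nK _ hu) hu)
      have e1 : t⁻¹ • (piR nK (s • F2hatK γ + t • piR wK (F2hatK γ)) -
          (s • F2hatK γ + t • piR wK (F2hatK γ))) =
          F2hatK γ + (gammaH γ - 1) • piR wK (F2hatK γ) := by
        rw [map_add, map_smul, map_smul, piR_nK, piR_nK_wK hγ]
        have e : s • F2hatK γ + t • (F2hatK γ + gammaH γ • piR wK (F2hatK γ)) -
            (s • F2hatK γ + t • piR wK (F2hatK γ)) =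
            t • (F2hatK γ + (gammaH γ - 1) • piR wK (F2hatK γ)) := by module
        rw [e, smul_smul, inv_mul_cancel₀ ht, one_smul]
      rw [e1] at h1
      -- The factor i - 1 cancels the w F̂₂-terms, leaving i(i - 1)² - 1 = 1 times F̂₂.
      have h2 := sub_mem (N.smul_mem (gammaH γ - 1) (hN wK _ h1)) h1
      have e2 : (gammaH γ - 1) • piR wK (F2hatK γ + (gammaH γ - 1) • piR wK (F2hatK γ)) -
          (F2hatK γ + (gammaH γ - 1) • piR wK (F2hatK γ)) = F2hatK γ := by
        rw [map_add, map_smul, piR_wK_wK]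
        have e : (gammaH γ - 1) ^ 2 * gammaH γ - 1 = 1 := by
          linear_combination (gammaH γ - 2) * hi
        refine Eq.trans (b := ((gammaH γ - 1) ^ 2 * gammaH γ - 1) • F2hatK γ) (by module) ?_
        rw [e, one_smul]
      rwa [e2] at h2
  refine Submodule.span_le.2 ?_
  rintro _ (rfl | rfl)
  · exact h0
  · exact hN _ _ h0

lemma F2hatK_ne_zero (hγ : IsGenuine γ) : F2hatK γ ≠ 0 :=
  (linearIndependent_F2hatK hγ).ne_zero 0

lemma isIrreducible_V2 (hγ : IsGenuine γ) : (V2rep γ).IsIrreducible where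
  exists_pair_ne := by
    refine ⟨⊥, ⊤, fun h => F2hatK_ne_zero hγ ?_⟩
    have : (⟨F2hatK γ, F2hatK_mem_V2⟩ : (V2 γ).toSubmodule) ∈
        (⊥ : Subrepresentation (V2rep γ)).toSubmodule := by
      rw [h]; exact Submodule.mem_top
    exact congrArg Subtype.val ((Submodule.mem_bot ℂ).1 this)
  eq_bot_or_eq_top := by
    intro N
    by_cases h : N.toSubmodule = ⊥
    · exact Or.inl (Subrepresentation.toSubmodule_injective h)
    · right
      apply Subrepresentation.toSubmodule_injective
      obtain ⟨u, hu, hu0⟩ := Submodule.exists_mem_ne_zero_of_ne_bot h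
      have key : spanF2hat γ ≤ N.toSubmodule.map (V2 γ).toSubmodule.subtype := by
        refine span_le_of_invariant hγ (u := u) ?_ ⟨u, hu, rfl⟩ (V2_eq_span hγ ▸ u.2)
          fun h => hu0 (Subtype.ext h)
        rintro k _ ⟨v, hv, rfl⟩
        exact ⟨V2rep γ k v, N.apply_mem_toSubmodule k hv, rfl⟩
      refine eq_top_iff.2 fun v _ => ?_
      have hv : (v : K → ℂ) ∈ spanF2hat γ := V2_eq_span hγ ▸ v.2
      obtain ⟨v', hv', e⟩ := key hv
      rwa [← Subtype.ext e]

/-! ### Spherical vectors -/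

section Rep

variable {V : Type*} [AddCommGroup V] [Module ℂ V] {π : Representation ℂ Cover V}

/-- The support of T_w consists of the four cosets nʲ w K₀, and T_w has the same value at each nʲ w
because nʲ lies in K₁. -/
lemma heckeAct_Tw (hγ : IsGenuine γ) {v : V} (hv : v ∈ gammaVectors γ π) :
    heckeAct π (Tw γ) v =
      ∑ j : Fin 4, ((1 - gammaH γ) / 2) • π (nElt 1 ^ (j : ℕ) * wOne) v := by
  unfold heckeAct
  rw [finsum_quotient_eq_sum K0 (F := fun g => Tw γ g • π g v) _
    (fun j : Fin 4 => nElt 1 ^ (j : ℕ) * wOne) (fun _ _ => nElt_mul_wOne_inj)]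
  · refine Finset.sum_congr rfl fun j _ => ?_
    have := Tw_apply hγ (K1_subset_K0 (nElt_pow_mem_K1 j)) (one_mem K0)
    rw [mul_one, extChar_K1 γ (nElt_pow_mem_K1 j), extChar_one, star_one, mul_one, one_mul] at this
    simp only [this]
  · intro g hg
    by_contra hne
    refine hg ?_
    rw [Tw_eq_zero, zero_smul]
    rintro k hk k' hk' rfl
    obtain ⟨j, l, hl, e⟩ := exists_eq_nElt_mul hk
    exact hne ⟨j, l * k', mul_mem hl hk', by rw [e, mul_assoc]⟩
  · intro g k hk
    have := Tw_mul γ (one_mem K0) hk g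
    rw [one_mul, extChar_one, star_one, one_mul, star_extChar γ hk] at this
    rw [this, map_mul, Module.End.mul_apply, hv k hk, map_smul, smul_smul, mul_assoc,
      extChar_inv_mul γ hk, mul_one]

lemma isSpherical_apply_F2hatK (hγ : IsGenuine γ)
    (l : (V2rep γ).IntertwiningMap (restrictK π)) (hl : l ≠ 0) :
    IsSpherical γ π (l ⟨F2hatK γ, F2hatK_mem_V2⟩) := by
  set f : (V2 γ).toSubmodule := ⟨F2hatK γ, F2hatK_mem_V2⟩
  have hlk (k : K) (φ : (V2 γ).toSubmodule) : π k (l φ) = l (V2rep γ k φ) :=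
    (LinearMap.congr_fun (l.isIntertwining' k) φ).symm
  have hmem : l f ∈ gammaVectors γ π := by
    intro k hk
    have := hlk ⟨k, K0_le_K hk⟩ f
    refine this.trans ?_
    rw [← map_smul]
    exact congrArg l (Subtype.ext (piR_of_mem_K0 (k := ⟨k, K0_le_K hk⟩) hk))
  refine ⟨hmem, ?_, ?_⟩
  · have := isIrreducible_V2 hγ
    have hinj := (Representation.IsIrreducible.injective_or_eq_zero l).resolve_right hl
    intro h
    rw [← map_zero l] at h
    exact F2hatK_ne_zero hγ (congrArg Subtype.val (hinj h))
  · rw [heckeAct_Tw hγ hmem]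
    have hn : π (nElt 1) (l f) = l f := by
      have := hmem (nElt 1) (nElt_mem_K0 1)
      rwa [extChar_nElt, one_smul] at this
    have hnw : π (nElt 1) (π wOne (l f)) = l f + gammaH γ • π wOne (l f) := by
      have h1 : π wOne (l f) = l (V2rep γ wK f) := hlk wK f
      rw [h1, ← map_smul, ← map_add]
      exact (hlk nK _).trans (congrArg l (Subtype.ext (piR_nK_wK hγ)))
    have hi := gammaH_sq hγ
    simp only [Fin.sum_univ_four, map_mul, map_pow, Module.End.mul_apply]
    generalize π wOne (l f) = u at *
    generalize l f = v at *
    generalize π (nElt 1) = T at *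
    change ((1 - gammaH γ) / 2) • (T ^ 0) u + ((1 - gammaH γ) / 2) • (T ^ 1) u +
      ((1 - gammaH γ) / 2) • (T ^ 2) u + ((1 - gammaH γ) / 2) • (T ^ 3) u = _
    simp only [pow_succ, pow_zero, one_mul, Module.End.mul_apply, Module.End.one_apply, hnw, hn,
      map_add, map_smul]
    -- With `u = w v`, iterating `n u = v + i u` and adding `u, nu, n²u, n³u` gives the coefficients
    -- 3 + 2i + i² of `v` and 1 + i + i² + i³ = 0 of `u`.
    have e1 : (1 - gammaH γ) / 2 * (3 + 2 * gammaH γ + gammaH γ ^ 2) = 2 := by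
      linear_combination (-(gammaH γ + 1) / 2) * hi
    have e2 : (1 - gammaH γ) / 2 * (1 + gammaH γ + gammaH γ ^ 2 + gammaH γ ^ 3) = 0 := by
      linear_combination ((1 - gammaH γ) * (1 + gammaH γ) / 2) * hi
    refine Eq.trans (b := ((1 - gammaH γ) / 2 * (3 + 2 * gammaH γ + gammaH γ ^ 2)) • v +
      ((1 - gammaH γ) / 2 * (1 + gammaH γ + gammaH γ ^ 2 + gammaH γ ^ 3)) • u) (by module) ?_
    rw [e1, e2, zero_smul, add_zero]

/-- The integral of `φ(k⁻¹) π(k) v` over `K`, for `φ ∈ I_K(γ)` and `v ∈ V^γ`. -/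
def frobenius (π : Representation ℂ Cover V) (v : V) : (K → ℂ) →ₗ[ℂ] V where
  toFun φ := ∑ᶠ q : K ⧸ K0inK, φ q.out⁻¹ • π q.out v
  map_add' φ ψ := by
    simp only [Pi.add_apply, add_smul]
    exact finsum_add_distrib (Set.toFinite _) (Set.toFinite _)
  map_smul' c φ := by
    simp only [Pi.smul_apply, smul_eq_mul, mul_smul, RingHom.id_apply]
    exact (smul_finsum' c (Set.toFinite _)).symm

/-- The free parameter `y` covers both the integrand of a translate of φ and, with `y = 1`, that of
φ itself. -/
lemma frobenius_invariant {v : V} (hv : v ∈ gammaVectors γ π) {φ : K → ℂ} (hφ : φ ∈ IK γ)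
    (y x k : K) (hk : k ∈ K0inK) :
    φ ((x * k)⁻¹ * y) • π (x * k : K) v = φ (x⁻¹ * y) • π x v := by
  have hk' : (k : Cover) ∈ K0 := hk
  rw [mul_inv_rev, mul_assoc, IK_inv_mul hφ hk, Subgroup.coe_mul, map_mul, Module.End.mul_apply,
    hv k hk', map_smul, smul_smul]
  congr 1
  linear_combination φ (x⁻¹ * y) * extChar_inv_mul γ hk'

lemma frobenius_piR {v : V} (hv : v ∈ gammaVectors γ π) {φ : K → ℂ} (hφ : φ ∈ IK γ) (k : K) :
    frobenius π v (piR k φ) = π k (frobenius π v φ) := by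
  have := Fintype.ofFinite (K ⧸ K0inK)
  change ∑ᶠ q : K ⧸ K0inK, φ (q.out⁻¹ * k) • π q.out v =
    π k (∑ᶠ q : K ⧸ K0inK, φ q.out⁻¹ • π q.out v)
  rw [finsum_quotient_translate K0inK (F := fun x : K => φ (x⁻¹ * k) • π x v)
    (frobenius_invariant hv hφ k) k, finsum_eq_sum_of_fintype, finsum_eq_sum_of_fintype, map_sum]
  refine Finset.sum_congr rfl fun q _ => ?_
  rw [mul_inv_rev, inv_mul_cancel_right, map_smul, Subgroup.coe_mul, map_mul, Module.End.mul_apply]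

lemma V2_le_IK (hγ : IsGenuine γ) : (V2 γ).toSubmodule ≤ IK γ := by
  have h : F2hatK γ ∈ IK γ := fun k₀ hk₀ k => F2hat_mul_left γ hk₀ k
  rw [V2_eq_span hγ]
  refine Submodule.span_le.2 ?_
  rintro _ (rfl | rfl)
  · exact h
  · intro k₀ hk₀ k
    rw [piR_apply, piR_apply, mul_assoc]
    exact h k₀ hk₀ _

/-- The representatives of the cosets of `K₀` in `K` on which `F₂` is supported. -/
def supportRep : Option (Fin 4) → K
  | none => 1
  | some j => nK ^ (j : ℕ) * wK

lemma supportRep_inj (i j : Option (Fin 4)) (h : (supportRep i)⁻¹ * supportRep j ∈ K0inK) :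
    i = j := by
  have hw (j : Fin 4) : nElt 1 ^ (j : ℕ) * wOne ∉ K0 :=
    not_mem_K0_of_eq (K1_subset_K0 (nElt_pow_mem_K1 j)) (one_mem K0) (mul_one _).symm
  rcases i with _ | i <;> rcases j with _ | j
  · rfl
  · refine absurd ?_ (hw j)
    have : (1 : Cover)⁻¹ * (nElt 1 ^ (j : ℕ) * wOne) ∈ K0 := h
    rwa [inv_one, one_mul] at this
  · refine absurd ?_ (hw i)
    have : (nElt 1 ^ (i : ℕ) * wOne)⁻¹ * 1 ∈ K0 := h
    rwa [mul_one, inv_mem_iff] at this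
  · exact congrArg some (nElt_mul_wOne_inj h)

/-- Since F̂₂(k⁻¹) = F₂(k), the integral is π(F₂)v = (T_w v + v)/3, which is v for the eigenvalue 2.
-/
lemma frobenius_F2hatK (hγ : IsGenuine γ) {v : V} (hv : IsSpherical γ π v) :
    frobenius π v (F2hatK γ) = v := by
  obtain ⟨hv, -, h2⟩ := hv
  rw [heckeAct_Tw hγ hv] at h2
  have hIK : F2hatK γ ∈ IK γ := V2_le_IK hγ F2hatK_mem_V2
  have hF (x : K) : F2hatK γ x⁻¹ = F2 γ x := congrArg (F2 γ) (inv_inv (x : Cover))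
  change ∑ᶠ q : K ⧸ K0inK, F2hatK γ q.out⁻¹ • π q.out v = v
  rw [finsum_quotient_eq_sum K0inK (F := fun x : K => F2hatK γ x⁻¹ • π x v) _ supportRep
    supportRep_inj]
  · have h0 : F2 γ (supportRep none) = 1 / 3 := by
      refine (F2_of_mem (one_mem K0)).trans ?_
      rw [extChar_one, star_one]
    have hj (j : Fin 4) : F2 γ (supportRep (some j)) = (1 - gammaH γ) / 6 := by
      have := F2_of_wOne hγ (K1_subset_K0 (nElt_pow_mem_K1 j)) (one_mem K0)
      rw [mul_one, extChar_K1 γ (nElt_pow_mem_K1 j), extChar_one, star_one, mul_one,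
        one_mul] at this
      exact this
    have h1 : π (supportRep none) v = v := by
      change π (1 : Cover) v = v
      rw [map_one]; rfl
    rw [Fintype.sum_option]
    simp only [hF, h0, hj, h1]
    have h3 : ∑ j : Fin 4, ((1 - gammaH γ) / 6) • π (supportRep (some j)) v =
        (1 / 3 : ℂ) • ((2 : ℂ) • v) := by
      rw [← h2, Finset.smul_sum]
      refine Finset.sum_congr rfl fun j _ => ?_
      rw [smul_smul]
      congr 1
      ring
    rw [h3]
    module
  · intro x hx
    by_contra hne
    refine hx ?_
    rw [hF, F2_eq_zero, zero_smul]
    · exact fun h => hne ⟨none, x, h, (one_mul x).symm⟩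
    · intro k hk k' hk' e
      obtain ⟨j, l, hl, e'⟩ := exists_eq_nElt_mul hk
      have hl' := mul_mem hl hk'
      refine hne ⟨some j, ⟨l * k', K0_le_K hl'⟩, hl', Subtype.ext ?_⟩
      rw [e, e', mul_assoc]
      rfl
  · intro x k hk
    simpa using frobenius_invariant hv hIK 1 x k hk

lemma isUnramified_iff (hγ : IsGenuine γ) : IsUnramified γ π ↔
    ∃ l : (V2rep γ).IntertwiningMap (restrictK π), l ≠ 0 := by
  constructor
  · rintro ⟨v, hv⟩
    refine ⟨LinearMap.intertwiningMap_of_isIntertwiningMap (V2rep γ) (restrictK π)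
      (frobenius π v ∘ₗ (V2 γ).toSubmodule.subtype)
      fun k φ => frobenius_piR hv.1 (V2_le_IK hγ φ.2) k, fun h => hv.2.1 ?_⟩
    rw [← frobenius_F2hatK hγ hv]
    exact DFunLike.congr_fun h (⟨F2hatK γ, F2hatK_mem_V2⟩ : (V2 γ).toSubmodule)
  · rintro ⟨l, hl⟩
    exact ⟨_, isSpherical_apply_F2hatK hγ l hl⟩

lemma IsSpherical.smul {v : V} (hγ : IsGenuine γ) (hv : IsSpherical γ π v) {c : ℂ} (hc : c ≠ 0) :
    IsSpherical γ π (c • v) := by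
  obtain ⟨h1, h0, h2⟩ := hv
  have h1' := (gammaVectors γ π).smul_mem c h1
  refine ⟨h1', smul_ne_zero hc h0, ?_⟩
  rw [heckeAct_Tw hγ h1] at h2
  rw [heckeAct_Tw hγ h1', smul_comm, ← h2, Finset.smul_sum]
  exact Finset.sum_congr rfl fun j _ => by rw [map_smul, smul_comm]

end Rep

end

end DyadicCover

theorem mainTheorem6
    (γ : Subgroup.center DyadicCover.Cover →* ℂˣ) (hγ : DyadicCover.IsGenuine γ)
    {V : Type*} [AddCommGroup V] [Module ℂ V] (π : Representation ℂ DyadicCover.Cover V)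
    (hsmooth : DyadicCover.IsSmooth π) (hcentral : DyadicCover.HasCentralCharacter π γ) :
    Module.finrank ℂ (DyadicCover.V2 γ).toSubmodule = 2 ∧
    (DyadicCover.V2rep γ).IsIrreducible ∧
    (DyadicCover.IsUnramified γ π ↔
      ∃ l : (DyadicCover.V2rep γ).IntertwiningMap (DyadicCover.restrictK π), l ≠ 0) ∧
    ∃ hF : DyadicCover.F2hatK γ ∈ (DyadicCover.V2 γ).toSubmodule,
      ∀ l : (DyadicCover.V2rep γ).IntertwiningMap (DyadicCover.restrictK π), l ≠ 0 →
        ∀ c : ℂ, c ≠ 0 →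
          DyadicCover.IsSpherical γ π (c • l ⟨DyadicCover.F2hatK γ, hF⟩) := 
  ⟨DyadicCover.finrank_V2 hγ, DyadicCover.isIrreducible_V2 hγ, DyadicCover.isUnramified_iff hγ,
    DyadicCover.F2hatK_mem_V2,
    fun l hl _ hc => (DyadicCover.isSpherical_apply_F2hatK hγ l hl).smul hγ hc⟩
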